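/- Let $d\ge 1$, let $E$ be a finite non-empty set, let $P$ be an irreducible stochastic matrix on $E$, and let $\mathcal V=\{\pm e_1,\dots,\pm e_d\}\subset\mathbb R^d$. For $x\in\mathbb R^d$ and $i\in E$ let $(p(x,i,v))_{v\in\mathcal V}$ be a probability vector with $p(x,i,v)>0$, and assume that there is a finite $K$ with $|p(x,i,v)-p(y,i,v)|\le K|x-y|$ for all $x,y\in\mathbb R^d$, $i\in E$, $v\in\mathcal V$. Let $(\xi_n)$ be the Markov chain with transition matrix $P$, write $\mathbb E^i$ for expectation when $\xi_0=i$, and put $$H(x,\alpha)=\lim_{n\to\infty}\frac1n\ln\mathbb E^i\prod_{k=1}^n\Big[\sum_{v\in\mathcal V}e^{\langle\alpha,v\rangle}p(x,\xi_k,v)\Big],\qquad L(x,v)=\sup_{\alpha\in\mathbb R^d}\{\langle\alpha,v\rangle-H(x,\alpha)\}\in[0,+\infty].$$ For $x\in[0,1]^d$ let $\mathcal N(x)$ be the set of $n\in\mathbb R^d$ with $|n|=1$ and, for each $\ell$, $n_\ell=0$ if $x_\ell\in(0,1)$, $n_\ell\le0$ if $x_\ell=0$, $n_\ell\ge0$ if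 $x_\ell=1$ (so $\mathcal N(x)=\emptyset$ for $x\in(0,1)^d$). For continuous $\psi:[0,T]\to\mathbb R^d$ with $\psi_0\in[0,1]^d$, write $\varphi=\Psi(\psi)$ if $\varphi:[0,T]\to[0,1]^d$ is the solution of the Skorokhod problem, that is, $\varphi$ is continuous and $k=\psi-\varphi$ has bounded variation with $k_t=\int_0^t n_s\,d|k|_s$, where $n_s\in\mathcal N(\varphi_s)$ for $d|k|$-almost every $s$ (so $d|k|$ is carried by $\{s:\varphi_s\in\partial[0,1]^d\}$). For $\varphi:[0,T]\to[0,1]^d$ put $$J_{0,T}(\varphi)=\inf\Big\{\int_0^TL(\varphi_s,\dot\psi_s)\,ds:\ \psi\text{ absolutely continuous},\ \Psi(\psi)=\varphi\Big\}\qquad(\inf\emptyset=+\infty),$$ and let $V(x)=V(0,x)=\inf\{J_{0,T}(\varphi):\ T>0,\ \varphi_0=0,\ \varphi_T=x\}$ be the quasi-potential. Then the limit defining $H(x,\alpha)$ exists and does not depend on $i$, $V$ is finite on $[0,1]^d$, and the following hold. (1) ($V$ is a viscosity subsolution and a bilateral supersolution of $H(x,\nabla V)=0$ in $(0,1)^d$.)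 For every $x\in(0,1)^d$ and every continuously differentiable function $\theta$ on an open neighbourhood $U\subset(0,1)^d$ of $x$: $H(x,\nabla\theta(x))\le0$ if $V-\theta$ has a local maximum at $x$, and $H(x,\nabla\theta(x))=0$ if $V-\theta$ has a local minimum at $x$. (2) (Boundary condition of Neumann type.) For every $x\in\partial[0,1]^d$, every open neighbourhood $U$ of $x$ and every continuously differentiable function $\theta$ on $U\cap[0,1]^d$ such that $V-\theta$ has a local minimum at $x$ on $U\cap[0,1]^d$: (a) if $x\neq0$ and $\langle\nabla\theta(x),n\rangle\ge0$ for all $n\in\mathcal N(x)$, then $H(x,\nabla\theta(x))\ge0$; (b) if $\langle\nabla\theta(x),n\rangle\le0$ for all $n\in\mathcal N(x)$, then $H(x,\nabla\theta(x))\le0$. -/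

import Mathlib

open Set Filter Topology MeasureTheory

/-- The cube `[0,1]^d` in Euclidean space. -/
def cube (d : ℕ) : Set (EuclideanSpace ℝ (Fin d)) :=
  {x | ∀ l, x l ∈ Icc (0 : ℝ) 1}

/-- The open cube `(0,1)^d`. -/
def openCube (d : ℕ) : Set (EuclideanSpace ℝ (Fin d)) :=
  {x | ∀ l, x l ∈ Ioo (0 : ℝ) 1}

/-- The set `𝒩(x)` of unit outward normals to the cube at `x`; it is empty when `x ∈ (0,1)^d`. -/
def outwardNormals {d : ℕ} (x : EuclideanSpace ℝ (Fin d)) : Set (EuclideanSpace ℝ (Fin d)) :=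
  {v | ‖v‖ = 1 ∧ ∀ l, (x l ∈ Ioo (0 : ℝ) 1 → v l = 0) ∧ (x l = 0 → v l ≤ 0) ∧ (x l = 1 → 0 ≤ v l)}

/-- The elements of `𝒱 = {e₁, -e₁, …, e_d, -e_d}` are indexed by pairs (coordinate, sign);
this is the vector with a given index. -/
noncomputable def jump {d : ℕ} (v : Fin d × ℤˣ) : EuclideanSpace ℝ (Fin d) :=
  EuclideanSpace.single v.1 (((v.2 : ℤˣ) : ℤ) : ℝ)

section Model

variable {d : ℕ} {E : Type*} [Fintype E]

/-- The probability that the chain with transition matrix `P` started from `ξ₀ = i` satisfies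
`(ξ₁, …, ξₙ) = (ω 0, …, ω (n-1))`. -/
def pathProb (P : Matrix E E ℝ) (i : E) {n : ℕ} (ω : Fin n → E) : ℝ :=
  ∏ k : Fin n, P ((Fin.cons i ω : Fin (n + 1) → E) k.castSucc)
    ((Fin.cons i ω : Fin (n + 1) → E) k.succ)

/-- The expectation `𝔼ⁱ ∏_{k=1}^n ∑_{v ∈ 𝒱} e^{⟨α, v⟩} p(x, ξ_k, v)`. -/
noncomputable def expMoment (P : Matrix E E ℝ)
    (p : EuclideanSpace ℝ (Fin d) → E → Fin d × ℤˣ → ℝ)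
    (i : E) (n : ℕ) (x α : EuclideanSpace ℝ (Fin d)) : ℝ :=
  ∑ ω : Fin n → E, pathProb P i ω *
    ∏ k : Fin n, ∑ v : Fin d × ℤˣ, Real.exp (inner ℝ α (jump v)) * p x (ω k) v

variable [Nonempty E]

/-- The Hamiltonian `H(x, α) = lim (1/n) log 𝔼ⁱ ∏_{k=1}^n ∑_v e^{⟨α, v⟩} p(x, ξ_k, v)`.
An arbitrary starting state is used here. -/
noncomputable def hamiltonian (P : Matrix E E ℝ)
    (p : EuclideanSpace ℝ (Fin d) → E → Fin d × ℤˣ → ℝ)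
    (x α : EuclideanSpace ℝ (Fin d)) : ℝ :=
  limUnder atTop fun n : ℕ =>
    (1 / (n : ℝ)) * Real.log (expMoment P p (Classical.arbitrary E) n x α)

/-- The Legendre transform `L(x, v) = sup_α (⟨α, v⟩ - H(x, α))`, possibly `+∞`. -/
noncomputable def lagrangian (P : Matrix E E ℝ)
    (p : EuclideanSpace ℝ (Fin d) → E → Fin d × ℤˣ → ℝ)
    (x v : EuclideanSpace ℝ (Fin d)) : EReal :=
  ⨆ α : EuclideanSpace ℝ (Fin d), ((inner ℝ α v - hamiltonian P p x α : ℝ) : EReal)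

/-- `φ = Ψ(ψ)` on `[0, T]`: the pair `(φ, ψ - φ)` solves the Skorokhod problem driven by `ψ` in
the cube with normal reflection. Thus `ψ = φ + k` with `k_t = ∫_{(0,t]} n_s dm(s)` and
`n_s ∈ 𝒩(φ_s)` for `m`-almost every `s`. Since `|n_s| = 1`, the path `k` has bounded variation
and `m` is its total variation measure `d|k|` on `(0, T]`; since `𝒩` is empty on the open cube,
`m` is carried by the times at which `φ` is on the boundary. -/
def IsSkorokhodSolution (T : ℝ) (ψ φ : ℝ → EuclideanSpace ℝ (Fin d)) : Prop :=
  ContinuousOn ψ (Icc 0 T) ∧ ContinuousOn φ (Icc 0 T) ∧ MapsTo φ (Icc 0 T) (cube d) ∧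
  ∃ (m : Measure ℝ) (n : ℝ → EuclideanSpace ℝ (Fin d)),
    IsFiniteMeasure m ∧ AEStronglyMeasurable n m ∧
    (∀ᵐ s ∂(m.restrict (Ioc 0 T)), n s ∈ outwardNormals (φ s)) ∧
    ∀ t ∈ Icc 0 T, ψ t = φ t + ∫ s in Ioc 0 t, n s ∂m

/-- The action `J_{0,T}(φ)`: the infimum of `∫₀ᵀ L(φ_s, ψ̇_s) ds` over the absolutely continuous
paths `ψ` with `Ψ(ψ) = φ` (and `+∞` if there is none). The Lagrangian is nonnegative because
`H(x, 0) = 0`, so that nothing is lost in passing to `[0, ∞]`. -/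
noncomputable def action (P : Matrix E E ℝ)
    (p : EuclideanSpace ℝ (Fin d) → E → Fin d × ℤˣ → ℝ)
    (T : ℝ) (φ : ℝ → EuclideanSpace ℝ (Fin d)) : ENNReal :=
  ⨅ (ψ : ℝ → EuclideanSpace ℝ (Fin d)) (_ : AbsolutelyContinuousOnInterval ψ 0 T)
    (_ : IsSkorokhodSolution T ψ φ),
    ∫⁻ s in Icc 0 T, (lagrangian P p (φ s) (deriv ψ s)).toENNReal

/-- The quasi-potential `V(x, y)`: the infimum of `J_{0,T}(φ)` over all `T > 0` and all paths
`φ : [0, T] → [0,1]^d` from `x` to `y`. -/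
noncomputable def quasiPotential (P : Matrix E E ℝ)
    (p : EuclideanSpace ℝ (Fin d) → E → Fin d × ℤˣ → ℝ)
    (x y : EuclideanSpace ℝ (Fin d)) : ENNReal :=
  ⨅ (T : ℝ) (_ : 0 < T) (φ : ℝ → EuclideanSpace ℝ (Fin d))
    (_ : MapsTo φ (Icc 0 T) (cube d)) (_ : φ 0 = x) (_ : φ T = y), action P p T φ

/-- The quasi-potential `V(x) = V(0, x)` from the origin, as a real number. -/
noncomputable def quasiPotentialZero (P : Matrix E E ℝ)
    (p : EuclideanSpace ℝ (Fin d) → E → Fin d × ℤˣ → ℝ)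
    (x : EuclideanSpace ℝ (Fin d)) : ℝ :=
  (quasiPotential P p 0 x).toReal

end Model

/-! ### Moments of the modulated chain and their exponential growth rate. -/

section Moments

variable {E : Type*}

/-! The analysis rests on three properties of `H`. The growth rate exists by Fekete's lemma:
irreducibility makes the moments from different starting states comparable uniformly in `n`, hence
submultiplicative up to a constant (`exists_tendsto_log_pathMoment`). Hölder's inequality makes
`H(x, ·)` convex. Unit jumps and a positive lower bound for `p` on the cube give `H(x, α) ≤ ‖α‖`,
linear growth from below, and a Lipschitz bound in `x` uniform in `α`.

The inequalities `H ≤ 0` use cheap test paths. By the dynamic programming bound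
`quasiPotential_add_smul_le`, arriving at or leaving `x` along a short straight segment with driving
velocity `v` costs about `t L(x, v)`. Comparison with `θ` gives `⟨α, v⟩ ≤ L(x, v)` for all `v`,
where `α = ∇θ(x)`, and duality turns this into `H(x, α) ≤ 0`. At the boundary the segment has the
reflected velocity `w = v - cN`, and the sign condition in (b) gives `⟨α, v⟩ ≤ ⟨α, w⟩`.

The inequality `H ≥ 0` uses every nearly optimal path to `x ≠ 0`. If `H(x, α) < 0`, then `H(·, α) ≤
-h < 0` near `x`. Fenchel's inequality bounds the cost of the last piece of the path inside a ball
of radius `r` below by `⟨α, ψ_T - ψ_τ⟩ + h (T - τ)`; the sign condition in (a) replaces `ψ` by `φ`.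
Finite action forces `|ψ̇| ≤ 1`, so `φ` is `√d`-Lipschitz and `T - τ ≥ r / √d`. The gain of order
`r` contradicts the local minimum (`exists_quasiPotentialZero_le`,
`hamiltonian_nonneg_of_localMin`). -/

lemma pathProb_cons (P : Matrix E E ℝ) (i j : E) {n : ℕ} (ω : Fin n → E) :
    pathProb P i (Fin.cons j ω : Fin (n + 1) → E) = P i j * pathProb P j ω := by
  unfold pathProb
  rw [Fin.prod_univ_succ]
  simp [Fin.castSucc_succ]

variable [Fintype E]

/-- The expectation `𝔼ⁱ ∏_{k=1}^n w(ξ_k)`, by recursion on the first step of the chain. -/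
def pathMoment (P : Matrix E E ℝ) (w : E → ℝ) : ℕ → E → ℝ
  | 0, _ => 1
  | n + 1, i => ∑ j, P i j * w j * pathMoment P w n j

lemma sum_pathProb_mul_prod (P : Matrix E E ℝ) (w : E → ℝ) (n : ℕ) (i : E) :
    ∑ ω : Fin n → E, pathProb P i ω * ∏ k, w (ω k) = pathMoment P w n i := by
  induction n generalizing i with
  | zero => simp [pathProb, pathMoment]
  | succ n ih =>
    rw [← (Fin.consEquiv (fun _ : Fin (n + 1) => E)).sum_comp, Fintype.sum_prod_type, pathMoment]
    refine Finset.sum_congr rfl fun j _ => ?_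
    rw [← ih, Finset.mul_sum]
    refine Finset.sum_congr rfl fun ω _ => ?_
    change pathProb P i (Fin.cons j ω : Fin (n + 1) → E) *
      ∏ k, w ((Fin.cons j ω : Fin (n + 1) → E) k) = _
    rw [pathProb_cons, Fin.prod_univ_succ]
    simp only [Fin.cons_zero, Fin.cons_succ]
    ring

variable {P : Matrix E E ℝ} {w w' : E → ℝ}

lemma pathMoment_const_one (hsum : ∀ i, ∑ j, P i j = 1) (n : ℕ) (i : E) :
    pathMoment P (fun _ => 1) n i = 1 := by
  induction n generalizing i with
  | zero => rfl
  | succ n ih => simp [pathMoment, ih, hsum]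

lemma pathMoment_pos (hP : ∀ i j, 0 ≤ P i j) (hsum : ∀ i, ∑ j, P i j = 1)
    (hw : ∀ j, 0 < w j) (n : ℕ) (i : E) : 0 < pathMoment P w n i := by
  induction n generalizing i with
  | zero => exact one_pos
  | succ n ih =>
    obtain ⟨j, hj⟩ : ∃ j, 0 < P i j := by
      by_contra! h
      have := Finset.sum_nonpos fun j (_ : j ∈ Finset.univ) => h j
      linarith [hsum i]
    exact Finset.sum_pos' (fun k _ => mul_nonneg (mul_nonneg (hP i k) (hw k).le) (ih k).le)
      ⟨j, Finset.mem_univ j, mul_pos (mul_pos hj (hw j)) (ih j)⟩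

lemma pathMoment_le_pow_mul (hP : ∀ i j, 0 ≤ P i j) (hsum : ∀ i, ∑ j, P i j = 1)
    (hw : ∀ j, 0 < w j) (hw' : ∀ j, 0 < w' j) {c : ℝ} (hc : 0 ≤ c) (h : ∀ j, w j ≤ c * w' j)
    (n : ℕ) (i : E) : pathMoment P w n i ≤ c ^ n * pathMoment P w' n i := by
  induction n generalizing i with
  | zero => simp [pathMoment]
  | succ n ih =>
    simp only [pathMoment]
    rw [Finset.mul_sum]
    refine Finset.sum_le_sum fun j _ => ?_
    calc P i j * w j * pathMoment P w n j
        ≤ P i j * (c * w' j) * (c ^ n * pathMoment P w' n j) := by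
          have := hP i j
          have := (hw' j).le
          have := (pathMoment_pos hP hsum hw n j).le
          gcongr
          · exact h j
          · exact ih j
      _ = c ^ (n + 1) * (P i j * w' j * pathMoment P w' n j) := by ring

lemma pathMoment_succ_le (hP : ∀ i j, 0 ≤ P i j) (hsum : ∀ i, ∑ j, P i j = 1)
    (hw : ∀ j, 0 < w j) {A : ℝ} (hA : ∀ j, w j ≤ A) (n : ℕ) (i : E) :
    pathMoment P w (n + 1) i ≤ A * pathMoment P w n i := by
  induction n generalizing i with
  | zero =>
    simp only [pathMoment, mul_one]
    calc ∑ j, P i j * w j ≤ ∑ j, P i j * A :=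
          Finset.sum_le_sum fun j _ => mul_le_mul_of_nonneg_left (hA j) (hP i j)
      _ = A := by rw [← Finset.sum_mul, hsum, one_mul]
  | succ n ih =>
    rw [pathMoment, pathMoment, Finset.mul_sum]
    refine Finset.sum_le_sum fun j _ => ?_
    calc P i j * w j * pathMoment P w (n + 1) j
        ≤ P i j * w j * (A * pathMoment P w n j) :=
          mul_le_mul_of_nonneg_left (ih j) (mul_nonneg (hP i j) (hw j).le)
      _ = A * (P i j * w j * pathMoment P w n j) := by ring

/-- Markov property at time `m`: whatever the state reached, the remaining `n` steps contribute at
most `S`. -/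
lemma pathMoment_add_le (hP : ∀ i j, 0 ≤ P i j) (hw : ∀ j, 0 < w j) {n : ℕ} {S : ℝ}
    (hS : ∀ j, pathMoment P w n j ≤ S) (m : ℕ) (i : E) :
    pathMoment P w (m + n) i ≤ pathMoment P w m i * S := by
  induction m generalizing i with
  | zero => simpa [pathMoment] using hS i
  | succ m ih =>
    rw [Nat.add_right_comm, pathMoment, pathMoment, Finset.sum_mul]
    refine Finset.sum_le_sum fun j _ => ?_
    calc P i j * w j * pathMoment P w (m + n) j
        ≤ P i j * w j * (pathMoment P w m j * S) :=
          mul_le_mul_of_nonneg_left (ih j) (mul_nonneg (hP i j) (hw j).le)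
      _ = P i j * w j * pathMoment P w m j * S := by ring

/-- Only the trajectories that are at `j` at time `k` are kept, and each of their first `k` weights
is at least `b`. -/
lemma pow_mul_pathMoment_le [DecidableEq E] (hP : ∀ i j, 0 ≤ P i j)
    (hsum : ∀ i, ∑ j, P i j = 1) (hw : ∀ j, 0 < w j) {b : ℝ} (hb : 0 ≤ b) (hbw : ∀ j, b ≤ w j)
    (n k : ℕ) (i j : E) :
    (P ^ k) i j * b ^ k * pathMoment P w n j ≤ pathMoment P w (n + k) i := by
  induction k generalizing i with
  | zero =>
    by_cases h : i = j
    · simp [h]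
    · simpa [Matrix.one_apply, h] using (pathMoment_pos hP hsum hw n i).le
  | succ k ih =>
    rw [pow_succ', Matrix.mul_apply, ← add_assoc, pathMoment, Finset.sum_mul, Finset.sum_mul]
    refine Finset.sum_le_sum fun l _ => ?_
    calc P i l * (P ^ k) l j * b ^ (k + 1) * pathMoment P w n j
        = P i l * b * ((P ^ k) l j * b ^ k * pathMoment P w n j) := by ring
      _ ≤ P i l * b * pathMoment P w (n + k) l :=
          mul_le_mul_of_nonneg_left (ih l) (mul_nonneg (hP i l) hb)
      _ ≤ P i l * w l * pathMoment P w (n + k) l := by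
          have := hP i l
          have := (pathMoment_pos hP hsum hw (n + k) l).le
          gcongr
          exact hbw l

/-- By irreducibility `j` is reached from `i` in some `k` steps, which bounds the moment of order `n
+ k` from `i` below by that of order `n` from `j`. The extra `k` steps cost at most a factor `(max
w)^k`. There are finitely many pairs, so one constant serves all. -/
lemma exists_pathMoment_le_mul [Nonempty E] (hsum : ∀ i, ∑ j, P i j = 1)
    (hirr : P.IsIrreducible) (hw : ∀ j, 0 < w j) :
    ∃ C : ℝ, 0 < C ∧ ∀ n i j, pathMoment P w n j ≤ C * pathMoment P w n i := by
  classical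
  have hP := hirr.nonneg
  obtain ⟨a, ha⟩ := Finite.exists_min w
  obtain ⟨z, hz⟩ := Finite.exists_max w
  have key : ∀ ij : E × E, ∃ C : ℝ, 0 < C ∧ ∀ n,
      pathMoment P w n ij.2 ≤ C * pathMoment P w n ij.1 := by
    rintro ⟨i, j⟩
    obtain ⟨k, -, hk⟩ := (Matrix.isIrreducible_iff_exists_pow_pos hP).1 hirr i j
    have hpos : 0 < (P ^ k) i j * w a ^ k := mul_pos hk (pow_pos (hw a) k)
    refine ⟨((P ^ k) i j * w a ^ k)⁻¹ * w z ^ k, mul_pos (inv_pos.2 hpos) (pow_pos (hw z) k),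
      fun n => ?_⟩
    have h1 := pow_mul_pathMoment_le hP hsum hw (hw a).le ha n k i j
    have h2 : ∀ k, pathMoment P w (n + k) i ≤ w z ^ k * pathMoment P w n i := by
      intro k
      induction k with
      | zero => simp
      | succ k ih =>
        calc pathMoment P w (n + k + 1) i ≤ w z * pathMoment P w (n + k) i :=
              pathMoment_succ_le hP hsum hw hz _ _
          _ ≤ w z * (w z ^ k * pathMoment P w n i) := mul_le_mul_of_nonneg_left ih (hw z).le
          _ = _ := by ring
    rw [mul_assoc, inv_mul_eq_div, le_div_iff₀ hpos, mul_comm]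
    exact h1.trans (h2 k)
  choose C hC hC' using key
  obtain ⟨m, hm⟩ := Finite.exists_max C
  exact ⟨C m, hC m, fun n i j => (hC' (i, j) n).trans
    (mul_le_mul_of_nonneg_right (hm (i, j)) (pathMoment_pos hP hsum hw n i).le)⟩

lemma exists_tendsto_log_pathMoment [Nonempty E] (hsum : ∀ i, ∑ j, P i j = 1)
    (hirr : P.IsIrreducible) (hw : ∀ j, 0 < w j) :
    ∃ ℓ : ℝ, ∀ i, Tendsto (fun n : ℕ => (1 / (n : ℝ)) * Real.log (pathMoment P w n i)) atTop
      (𝓝 ℓ) := by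
  have hP := hirr.nonneg
  obtain ⟨C, hC, hcomp⟩ := exists_pathMoment_le_mul hsum hirr hw
  obtain ⟨a, ha⟩ := Finite.exists_min w
  obtain ⟨i₀⟩ := ‹Nonempty E›
  have hpos := pathMoment_pos hP hsum hw
  -- The factor `C` absorbs the comparison constant, which makes `s` exactly subadditive.
  set s : ℕ → ℝ := fun n => Real.log (C * pathMoment P w n i₀) with hs
  have hC1 : 1 ≤ C := by simpa [pathMoment] using hcomp 0 i₀ i₀
  have hsub : Subadditive s := by
    intro m n
    simp only [hs]
    rw [← Real.log_mul (mul_pos hC (hpos m i₀)).ne' (mul_pos hC (hpos n i₀)).ne']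
    refine Real.log_le_log (mul_pos hC (hpos _ _)) ?_
    rw [mul_assoc]
    exact mul_le_mul_of_nonneg_left
      (pathMoment_add_le hP hw (fun j => hcomp n i₀ j) m i₀) hC.le
  have hbdd : BddBelow (range fun n => s n / n) := by
    -- The value `0` is needed for `n = 0`, where `s 0 / 0 = 0`.
    refine ⟨min (Real.log (w a)) 0, ?_⟩
    rintro _ ⟨n, rfl⟩
    rcases Nat.eq_zero_or_pos n with rfl | hn
    · simp
    · have hn' : (0 : ℝ) < n := Nat.cast_pos.2 hn
      refine (min_le_left _ _).trans ?_
      show Real.log (w a) ≤ s n / n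
      rw [le_div_iff₀ hn', mul_comm, ← Real.log_pow]
      refine Real.log_le_log (pow_pos (hw a) n) ?_
      have h1 := pathMoment_le_pow_mul (w := fun _ => 1) (w' := w) hP hsum (fun _ => one_pos) hw
        (inv_pos.2 (hw a)).le (fun j => by
          rw [inv_mul_eq_div, le_div_iff₀ (hw a), one_mul]; exact ha j) n i₀
      rw [pathMoment_const_one hsum, inv_pow, inv_mul_eq_div, le_div_iff₀ (pow_pos (hw a) n),
        one_mul] at h1
      exact h1.trans (le_mul_of_one_le_left (hpos _ _).le hC1)
  have hlim := hsub.tendsto_lim hbdd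
  refine ⟨hsub.lim, fun i => ?_⟩
  have hdiff : Tendsto (fun n : ℕ =>
      (Real.log (pathMoment P w n i) - s n) * ((n : ℝ))⁻¹) atTop (𝓝 0) := by
    refine bdd_le_mul_tendsto_zero' (2 * Real.log C) (Eventually.of_forall fun n => ?_)
      tendsto_inv_atTop_nhds_zero_nat
    have e : s n = Real.log C + Real.log (pathMoment P w n i₀) :=
      Real.log_mul hC.ne' (hpos _ _).ne'
    have h1 := Real.log_le_log (hpos _ _) (hcomp n i₀ i)
    have h2 := Real.log_le_log (hpos _ _) (hcomp n i i₀)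
    rw [Real.log_mul hC.ne' (hpos _ _).ne'] at h1 h2
    have h3 := Real.log_nonneg hC1
    rw [abs_le]
    constructor <;> linarith
  have := hlim.add hdiff
  rw [add_zero] at this
  refine this.congr fun n => ?_
  rw [one_div, div_eq_mul_inv]
  ring

lemma Real.sum_rpow_mul_rpow_le {ι : Type*} (t : Finset ι) {f g : ι → ℝ} (hf : ∀ j ∈ t, 0 ≤ f j)
    (hg : ∀ j ∈ t, 0 ≤ g j) {a b : ℝ} (ha : 0 < a) (hb : 0 < b) (hab : a + b = 1) :
    ∑ j ∈ t, f j ^ a * g j ^ b ≤ (∑ j ∈ t, f j) ^ a * (∑ j ∈ t, g j) ^ b := by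
  have hpq : (a⁻¹).HolderConjugate b⁻¹ := by
    rw [Real.holderConjugate_iff]
    refine ⟨one_lt_inv_iff₀.2 ⟨ha, by linarith⟩, by simpa using hab⟩
  have h := Real.inner_le_Lp_mul_Lq_of_nonneg t hpq (f := fun j => f j ^ a) (g := fun j => g j ^ b)
    (fun j hj => Real.rpow_nonneg (hf j hj) _) (fun j hj => Real.rpow_nonneg (hg j hj) _)
  simp only [one_div, inv_inv] at h
  refine h.trans_eq ?_
  congr 2 <;> refine Finset.sum_congr rfl fun j hj => ?_
  · exact Real.rpow_rpow_inv (hf j hj) ha.ne'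
  · exact Real.rpow_rpow_inv (hg j hj) hb.ne'

/-- Hölder's inequality at each step of the recursion: the moments are log-convex in the weights.
This is the source of the convexity of `H`. -/
lemma pathMoment_le_rpow_mul_rpow (hP : ∀ i j, 0 ≤ P i j) (hsum : ∀ i, ∑ j, P i j = 1)
    {u : E → ℝ} (hu : ∀ j, 0 < u j) (hw : ∀ j, 0 < w j) (hw' : ∀ j, 0 < w' j) {a b : ℝ}
    (ha : 0 < a) (hb : 0 < b) (hab : a + b = 1) (h : ∀ j, u j ≤ w j ^ a * w' j ^ b)
    (n : ℕ) (i : E) :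
    pathMoment P u n i ≤ pathMoment P w n i ^ a * pathMoment P w' n i ^ b := by
  induction n generalizing i with
  | zero => simp [pathMoment]
  | succ n ih =>
    have hpw := pathMoment_pos hP hsum hw n
    have hpw' := pathMoment_pos hP hsum hw' n
    simp only [pathMoment]
    refine le_trans (Finset.sum_le_sum fun j _ => ?_) (Real.sum_rpow_mul_rpow_le Finset.univ
      (fun j _ => mul_nonneg (mul_nonneg (hP i j) (hw j).le) (hpw j).le)
      (fun j _ => mul_nonneg (mul_nonneg (hP i j) (hw' j).le) (hpw' j).le) ha hb hab)
    rw [Real.mul_rpow (mul_nonneg (hP i j) (hw j).le) (hpw j).le,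
      Real.mul_rpow (mul_nonneg (hP i j) (hw' j).le) (hpw' j).le,
      Real.mul_rpow (hP i j) (hw j).le, Real.mul_rpow (hP i j) (hw' j).le]
    have e : P i j = P i j ^ a * P i j ^ b := by
      rw [← Real.rpow_add_of_nonneg (hP i j) ha.le hb.le, hab, Real.rpow_one]
    calc P i j * u j * pathMoment P u n j
        ≤ P i j * (w j ^ a * w' j ^ b) *
            (pathMoment P w n j ^ a * pathMoment P w' n j ^ b) := by
          have := hP i j
          have := (pathMoment_pos hP hsum hu n j).le
          have := Real.rpow_nonneg (hw j).le a
          have := Real.rpow_nonneg (hw' j).le b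
          gcongr
          · exact h j
          · exact ih j
      _ = (P i j ^ a * P i j ^ b) * (w j ^ a * w' j ^ b) *
            (pathMoment P w n j ^ a * pathMoment P w' n j ^ b) := by rw [← e]
      _ = _ := by ring

end Moments

/-! ### Convexity, regularity and growth of the Hamiltonian; duality with the Lagrangian. -/

section Hamiltonian

variable {d : ℕ} {E : Type*}

/-- The moment generating function `∑_v e^{⟨α, v⟩} p(x, i, v)` of a jump. -/
noncomputable def jumpMgf (p : EuclideanSpace ℝ (Fin d) → E → Fin d × ℤˣ → ℝ)
    (x : EuclideanSpace ℝ (Fin d)) (i : E) (α : EuclideanSpace ℝ (Fin d)) : ℝ :=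
  ∑ v : Fin d × ℤˣ, Real.exp (inner ℝ α (jump v)) * p x i v

variable [Fintype E]

/-- The standing assumptions: `P` is stochastic and irreducible, and `p` is a positive Markov
kernel which is Lipschitz in space. -/
structure IsJumpModel (P : Matrix E E ℝ)
    (p : EuclideanSpace ℝ (Fin d) → E → Fin d × ℤˣ → ℝ) : Prop where
  row_sum : ∀ i, ∑ j, P i j = 1
  irreducible : P.IsIrreducible
  sum_eq_one : ∀ x i, ∑ v, p x i v = 1
  pos : ∀ x i v, 0 < p x i v
  lipschitz : ∃ K : ℝ, ∀ x y i v, |p x i v - p y i v| ≤ K * ‖x - y‖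

lemma expMoment_eq_pathMoment (P : Matrix E E ℝ)
    (p : EuclideanSpace ℝ (Fin d) → E → Fin d × ℤˣ → ℝ) (i : E) (n : ℕ)
    (x α : EuclideanSpace ℝ (Fin d)) :
    expMoment P p i n x α = pathMoment P (fun j => jumpMgf p x j α) n i :=
  sum_pathProb_mul_prod P (fun j => jumpMgf p x j α) n i

lemma norm_jump (v : Fin d × ℤˣ) : ‖jump v‖ = 1 := by
  rcases Int.units_eq_one_or v.2 with h | h <;> simp [jump, h]

lemma isClosed_cube : IsClosed (cube d) := by
  have : cube d = ⋂ l, {x : EuclideanSpace ℝ (Fin d) | x l ∈ Icc (0 : ℝ) 1} := by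
    ext; simp [cube]
  rw [this]
  exact isClosed_iInter fun l => isClosed_Icc.preimage (by fun_prop)

lemma isCompact_cube : IsCompact (cube d) := by
  refine Metric.isCompact_of_isClosed_isBounded isClosed_cube ?_
  refine (Metric.isBounded_iff_subset_closedBall 0).2 ⟨√(∑ _l : Fin d, 1), fun x hx => ?_⟩
  rw [mem_closedBall_zero_iff, EuclideanSpace.norm_eq]
  refine Real.sqrt_le_sqrt (Finset.sum_le_sum fun l _ => ?_)
  rw [Real.norm_eq_abs, sq_abs]
  nlinarith [(hx l).1, (hx l).2]

lemma zero_mem_cube : (0 : EuclideanSpace ℝ (Fin d)) ∈ cube d := fun l => by simp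

lemma openCube_subset_cube : openCube d ⊆ cube d := fun _ hx l => Ioo_subset_Icc_self (hx l)

namespace IsJumpModel

variable {P : Matrix E E ℝ} {p : EuclideanSpace ℝ (Fin d) → E → Fin d × ℤˣ → ℝ}
  (M : IsJumpModel P p)
include M

/-- For `d = 0` the empty sum could not equal `1`, so the model itself forces `d ≥ 1`. -/
lemma nonempty_index [Nonempty E] : Nonempty (Fin d × ℤˣ) := by
  by_contra h
  rw [not_nonempty_iff] at h
  simpa using M.sum_eq_one 0 (Classical.arbitrary E)

lemma jumpMgf_pos [Nonempty E] (x : EuclideanSpace ℝ (Fin d)) (i : E)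
    (α : EuclideanSpace ℝ (Fin d)) : 0 < jumpMgf p x i α :=
  have := M.nonempty_index
  Finset.sum_pos (fun v _ => mul_pos (Real.exp_pos _) (M.pos x i v)) Finset.univ_nonempty

lemma jumpMgf_zero (x : EuclideanSpace ℝ (Fin d)) (i : E) : jumpMgf p x i 0 = 1 := by
  simp [jumpMgf, M.sum_eq_one]

lemma jumpMgf_le_exp_norm_sub (x : EuclideanSpace ℝ (Fin d)) (i : E)
    (α β : EuclideanSpace ℝ (Fin d)) :
    jumpMgf p x i α ≤ Real.exp ‖α - β‖ * jumpMgf p x i β := by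
  rw [jumpMgf, jumpMgf, Finset.mul_sum]
  refine Finset.sum_le_sum fun v _ => ?_
  rw [← mul_assoc, ← Real.exp_add]
  refine mul_le_mul_of_nonneg_right (Real.exp_le_exp.2 ?_) (M.pos x i v).le
  have h := real_inner_le_norm (α - β) (jump v)
  rw [norm_jump, mul_one, inner_sub_left] at h
  linarith

variable [Nonempty E]

lemma tendsto_hamiltonian (x α : EuclideanSpace ℝ (Fin d)) (i : E) :
    Tendsto (fun n : ℕ => (1 / (n : ℝ)) *
      Real.log (pathMoment P (fun j => jumpMgf p x j α) n i)) atTop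
      (𝓝 (hamiltonian P p x α)) := by
  obtain ⟨ℓ, hℓ⟩ := exists_tendsto_log_pathMoment M.row_sum M.irreducible
    (fun j => M.jumpMgf_pos x j α)
  have : hamiltonian P p x α = ℓ := by
    rw [hamiltonian]
    refine Tendsto.limUnder_eq ?_
    simp only [expMoment_eq_pathMoment]
    exact hℓ _
  rw [this]
  exact hℓ i

/-- A factor `e^c` per step becomes `e^{cn}` after `n` steps, hence `c` in the growth rate. All
Lipschitz and growth bounds on `H` come from this comparison. -/
lemma hamiltonian_le_add {x y α β : EuclideanSpace ℝ (Fin d)} {c : ℝ}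
    (h : ∀ j, jumpMgf p x j α ≤ Real.exp c * jumpMgf p y j β) :
    hamiltonian P p x α ≤ hamiltonian P p y β + c := by
  let i : E := Classical.arbitrary E
  refine le_of_tendsto_of_tendsto (M.tendsto_hamiltonian x α i)
    ((M.tendsto_hamiltonian y β i).add_const c) ?_
  filter_upwards [eventually_gt_atTop 0] with n hn
  have hn' : (0 : ℝ) < n := Nat.cast_pos.2 hn
  have hx := pathMoment_pos M.irreducible.nonneg M.row_sum (fun j => M.jumpMgf_pos x j α) n i
  have hy := pathMoment_pos M.irreducible.nonneg M.row_sum (fun j => M.jumpMgf_pos y j β) n i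
  have h1 := Real.log_le_log hx (pathMoment_le_pow_mul M.irreducible.nonneg M.row_sum
    (fun j => M.jumpMgf_pos x j α) (fun j => M.jumpMgf_pos y j β) (Real.exp_pos c).le h n i)
  rw [Real.log_mul (pow_pos (Real.exp_pos c) n).ne' hy.ne', Real.log_pow, Real.log_exp] at h1
  have h2 := mul_le_mul_of_nonneg_left h1 (one_div_pos.2 hn').le
  refine h2.trans_eq ?_
  field_simp
  ring

lemma hamiltonian_zero (x : EuclideanSpace ℝ (Fin d)) : hamiltonian P p x 0 = 0 := by
  refine tendsto_nhds_unique (M.tendsto_hamiltonian x 0 (Classical.arbitrary E)) ?_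
  simp [M.jumpMgf_zero, pathMoment_const_one M.row_sum]

lemma hamiltonian_le_add_norm_sub (x α β : EuclideanSpace ℝ (Fin d)) :
    hamiltonian P p x α ≤ hamiltonian P p x β + ‖α - β‖ :=
  M.hamiltonian_le_add fun j => M.jumpMgf_le_exp_norm_sub x j α β

lemma hamiltonian_le_norm (x α : EuclideanSpace ℝ (Fin d)) : hamiltonian P p x α ≤ ‖α‖ := by
  simpa [M.hamiltonian_zero] using M.hamiltonian_le_add_norm_sub x α 0

lemma continuous_hamiltonian (x : EuclideanSpace ℝ (Fin d)) :
    Continuous (hamiltonian P p x) :=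
  (LipschitzWith.of_le_add fun α β => by
    rw [dist_eq_norm]; exact M.hamiltonian_le_add_norm_sub x α β).continuous

lemma convexOn_hamiltonian (x : EuclideanSpace ℝ (Fin d)) :
    ConvexOn ℝ univ (hamiltonian P p x) := by
  refine convexOn_iff_forall_pos.2 ⟨convex_univ, fun α _ β _ a b ha hb hab => ?_⟩
  let i : E := Classical.arbitrary E
  have hmgf : ∀ j, jumpMgf p x j (a • α + b • β) ≤ jumpMgf p x j α ^ a * jumpMgf p x j β ^ b := by
    intro j
    refine le_trans (Finset.sum_le_sum fun v _ => ?_) (Real.sum_rpow_mul_rpow_le Finset.univ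
      (fun v _ => mul_nonneg (Real.exp_pos _).le (M.pos x j v).le)
      (fun v _ => mul_nonneg (Real.exp_pos _).le (M.pos x j v).le) ha hb hab)
    have hp := (M.pos x j v).le
    have e : p x j v = p x j v ^ a * p x j v ^ b := by
      rw [← Real.rpow_add_of_nonneg hp ha.le hb.le, hab, Real.rpow_one]
    rw [Real.mul_rpow (Real.exp_pos _).le hp, Real.mul_rpow (Real.exp_pos _).le hp,
      inner_add_left, real_inner_smul_left, real_inner_smul_left, Real.exp_add,
      mul_comm a, mul_comm b, Real.exp_mul, Real.exp_mul]
    nth_rewrite 1 [e]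
    apply le_of_eq
    ring
  have hlim := (((M.tendsto_hamiltonian x α i).const_mul a).add
    ((M.tendsto_hamiltonian x β i).const_mul b))
  refine le_of_tendsto_of_tendsto' (M.tendsto_hamiltonian x (a • α + b • β) i) hlim fun n => ?_
  have hp := fun γ => pathMoment_pos M.irreducible.nonneg M.row_sum
    (fun j => M.jumpMgf_pos x j γ) n i
  have h := Real.log_le_log (hp _) (pathMoment_le_rpow_mul_rpow M.irreducible.nonneg M.row_sum
    (fun j => M.jumpMgf_pos x j _) (fun j => M.jumpMgf_pos x j α)
    (fun j => M.jumpMgf_pos x j β) ha hb hab hmgf n i)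
  rw [Real.log_mul (Real.rpow_pos_of_pos (hp α) _).ne' (Real.rpow_pos_of_pos (hp β) _).ne',
    Real.log_rpow (hp α), Real.log_rpow (hp β)] at h
  refine (mul_le_mul_of_nonneg_left h (one_div_nonneg.2 n.cast_nonneg)).trans_eq ?_
  ring

lemma exists_pos_le : ∃ c : ℝ, 0 < c ∧ ∀ x ∈ cube d, ∀ i v, c ≤ p x i v := by
  obtain ⟨K, hK⟩ := M.lipschitz
  have hcont : ∀ i v, Continuous fun x => p x i v := by
    intro i v
    refine (LipschitzWith.of_dist_le_mul (K := K.toNNReal) fun x y => ?_).continuous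
    rw [Real.dist_eq, dist_eq_norm]
    exact (hK x y i v).trans
      (mul_le_mul_of_nonneg_right (Real.le_coe_toNNReal K) (norm_nonneg _))
  have key : ∀ iv : E × (Fin d × ℤˣ), ∃ c : ℝ, 0 < c ∧ ∀ x ∈ cube d, c ≤ p x iv.1 iv.2 := by
    rintro ⟨i, v⟩
    obtain ⟨x, -, hx⟩ := isCompact_cube.exists_isMinOn ⟨0, zero_mem_cube⟩
      (hcont i v).continuousOn
    exact ⟨p x i v, M.pos x i v, fun y hy => hx hy⟩
  choose c hc hc' using key
  have := M.nonempty_index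
  obtain ⟨m, hm⟩ := Finite.exists_min c
  exact ⟨c m, hc m, fun x hx i v => (hm (i, v)).trans (hc' (i, v) x hx)⟩

/-- With `p ≥ c` on the cube, `p(x) / p(y) ≤ 1 + (|K| / c) ‖x - y‖ ≤ exp ((|K| / c) ‖x - y‖)` for
each jump separately, so the constant does not depend on `α`. -/
lemma exists_hamiltonian_lipschitz : ∃ C : ℝ, 0 ≤ C ∧ ∀ x ∈ cube d, ∀ y ∈ cube d, ∀ α,
    hamiltonian P p x α ≤ hamiltonian P p y α + C * ‖x - y‖ := by
  obtain ⟨c, hc, hcp⟩ := M.exists_pos_le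
  obtain ⟨K, hK⟩ := M.lipschitz
  refine ⟨|K| / c, div_nonneg (abs_nonneg K) hc.le, fun x _ y hy α => ?_⟩
  refine M.hamiltonian_le_add fun j => ?_
  rw [jumpMgf, jumpMgf, Finset.mul_sum]
  refine Finset.sum_le_sum fun v _ => ?_
  rw [mul_left_comm]
  refine mul_le_mul_of_nonneg_left ?_ (Real.exp_pos _).le
  have h0 : 0 ≤ |K| / c * ‖x - y‖ := by positivity
  have h1 := (abs_le.1 (hK x y j v)).2
  have h2 : K * ‖x - y‖ ≤ |K| * ‖x - y‖ := mul_le_mul_of_nonneg_right (le_abs_self K) (norm_nonneg _)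
  calc p x j v ≤ p y j v + |K| * ‖x - y‖ := by linarith
    _ = p y j v + |K| / c * ‖x - y‖ * c := by field_simp
    _ ≤ p y j v + |K| / c * ‖x - y‖ * p y j v := by
        have := mul_le_mul_of_nonneg_left (hcp y hy j v) h0
        linarith
    _ = (|K| / c * ‖x - y‖ + 1) * p y j v := by ring
    _ ≤ _ := mul_le_mul_of_nonneg_right (Real.add_one_le_exp _) (M.pos y j v).le

/-- The jump along `± e_l` alone contributes at least `c e^{|α_l|}` to the generating function. This
growth bounds `L` at small velocities and so makes `V` finite. -/
lemma exists_abs_le_hamiltonian_add : ∃ C : ℝ, 0 ≤ C ∧ ∀ x ∈ cube d, ∀ α l,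
    |α l| ≤ hamiltonian P p x α + C := by
  obtain ⟨c, hc, hcp⟩ := M.exists_pos_le
  have main : ∀ x ∈ cube d, ∀ α l, |α l| ≤ hamiltonian P p x α + -Real.log c := by
    intro x hx α l
    have h := M.hamiltonian_le_add (x := x) (y := x) (α := 0) (β := α)
      (c := -Real.log c - |α l|) (fun j => ?_)
    · rw [M.hamiltonian_zero] at h
      linarith
    · rw [M.jumpMgf_zero]
      obtain ⟨v, hv⟩ : ∃ v : Fin d × ℤˣ, inner ℝ α (jump v) = |α l| := by
        rcases abs_choice (α l) with h | h
        · exact ⟨(l, 1), by simp [jump, h, EuclideanSpace.inner_single_right]⟩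
        · exact ⟨(l, -1), by simp [jump, h, EuclideanSpace.inner_single_right]⟩
      have h1 : Real.exp |α l| * c ≤ jumpMgf p x j α := by
        calc Real.exp |α l| * c ≤ Real.exp (inner ℝ α (jump v)) * p x j v := by
              rw [hv]; exact mul_le_mul_of_nonneg_left (hcp x hx j v) (Real.exp_pos _).le
          _ ≤ _ := Finset.single_le_sum
              (f := fun v => Real.exp (inner ℝ α (jump v)) * p x j v)
              (fun v _ => mul_nonneg (Real.exp_pos _).le (M.pos x j v).le) (Finset.mem_univ v)
      calc (1 : ℝ) = Real.exp (-Real.log c - |α l|) * (Real.exp |α l| * c) := by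
            rw [← mul_assoc, ← Real.exp_add, sub_add_cancel, Real.exp_neg, Real.exp_log hc,
              inv_mul_cancel₀ hc.ne']
        _ ≤ _ := mul_le_mul_of_nonneg_left h1 (Real.exp_pos _).le
  exact ⟨|(-Real.log c)|, abs_nonneg _, fun x hx α l =>
    (main x hx α l).trans (add_le_add_right (le_abs_self _) _)⟩

omit M in
lemma le_lagrangian (x v α : EuclideanSpace ℝ (Fin d)) :
    ((inner ℝ α v - hamiltonian P p x α : ℝ) : EReal) ≤ lagrangian P p x v :=
  le_iSup (fun α => ((inner ℝ α v - hamiltonian P p x α : ℝ) : EReal)) α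

omit M in
lemma lagrangian_le {x v : EuclideanSpace ℝ (Fin d)} {B : ℝ}
    (h : ∀ α, inner ℝ α v - hamiltonian P p x α ≤ B) : lagrangian P p x v ≤ B :=
  iSup_le fun α => EReal.coe_le_coe_iff.2 (h α)

/-- A form of the duality `H = L*`: some velocity `v` nearly attains the supremum defining
`H(x, α)` from `L(x, ·)`. -/
lemma exists_velocity {x α : EuclideanSpace ℝ (Fin d)} {a : ℝ} (ha : a < hamiltonian P p x α) :
    ∃ v : EuclideanSpace ℝ (Fin d), ∀ β,
      inner ℝ β v - hamiltonian P p x β ≤ inner ℝ α v - a := by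
  -- An affine minorant of the convex function `H(x, ·)` with value `a` at `α`; its slope, read as a
  -- vector, is the velocity.
  obtain ⟨l, c, hle, heq⟩ := (M.convexOn_hamiltonian x).exists_affine_le_of_lt (𝕜 := ℝ)
    (mem_univ α) ha isClosed_univ
    ((M.continuous_hamiltonian x).lowerSemicontinuous.lowerSemicontinuousOn univ)
  refine ⟨(InnerProductSpace.toDual ℝ _).symm l, fun β => ?_⟩
  have h := hle ⟨β, mem_univ β⟩
  simp only [Pi.add_apply, domRestrict_apply, Function.comp_apply, Function.const_apply,
    RCLike.re_to_real] at h heq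
  rw [real_inner_comm, InnerProductSpace.toDual_symm_apply, real_inner_comm,
    InnerProductSpace.toDual_symm_apply]
  linarith

end IsJumpModel

end Hamiltonian

/-! ### Lower bounds on the action and speed bounds for Skorokhod solutions. -/

section Paths

variable {d : ℕ}

lemma ENNReal.ofReal_integral_le_lintegral_ofReal {Ω : Type*} [MeasurableSpace Ω] {μ : Measure Ω}
    {f : Ω → ℝ} (hf : Integrable f μ) :
    ENNReal.ofReal (∫ x, f x ∂μ) ≤ ∫⁻ x, ENNReal.ofReal (f x) ∂μ := by
  calc ENNReal.ofReal (∫ x, f x ∂μ) ≤ ENNReal.ofReal (∫ x, max (f x) 0 ∂μ) :=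
        ENNReal.ofReal_le_ofReal (integral_mono hf hf.pos_part fun x => le_max_left _ _)
    _ = ∫⁻ x, ENNReal.ofReal (max (f x) 0) ∂μ :=
        ofReal_integral_eq_lintegral_ofReal hf.pos_part
          (Eventually.of_forall fun x => le_max_right _ _)
    _ = _ := by simp

lemma AbsolutelyContinuousOnInterval.inner_left {ψ : ℝ → EuclideanSpace ℝ (Fin d)} {a b : ℝ}
    (hψ : AbsolutelyContinuousOnInterval ψ a b) (β : EuclideanSpace ℝ (Fin d)) :
    AbsolutelyContinuousOnInterval (fun s => inner ℝ β (ψ s)) a b := by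
  unfold AbsolutelyContinuousOnInterval at hψ ⊢
  have hlim := hψ.const_mul ‖β‖
  rw [mul_zero] at hlim
  refine squeeze_zero (fun t ↦ ?_) (fun t ↦ ?_) hlim
  · exact Finset.sum_nonneg (fun i hi ↦ dist_nonneg)
  · rw [Finset.mul_sum]
    refine Finset.sum_le_sum fun i _ => ?_
    rw [Real.dist_eq, ← inner_sub_right, dist_eq_norm]
    exact abs_real_inner_le_norm _ _

lemma AbsolutelyContinuousOnInterval.ae_hasDerivAt {ψ : ℝ → EuclideanSpace ℝ (Fin d)} {a b : ℝ}
    (hψ : AbsolutelyContinuousOnInterval ψ a b) :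
    ∀ᵐ s : ℝ, s ∈ uIcc a b → HasDerivAt ψ (deriv ψ s) s := by
  filter_upwards [hψ.boundedVariationOn.ae_differentiableAt_of_mem_uIcc] with s hs hs'
  exact (hs hs').hasDerivAt

section Lagrangian

variable {E : Type*} [Fintype E] [Nonempty E] {P : Matrix E E ℝ}
  {p : EuclideanSpace ℝ (Fin d) → E → Fin d × ℤˣ → ℝ}

/-- Fenchel's inequality `L ≥ ⟨β, ψ̇⟩ - H ≥ ⟨β, ψ̇⟩ - c`, integrated in time. -/
lemma ofReal_le_lintegral_lagrangian {ψ φ : ℝ → EuclideanSpace ℝ (Fin d)} {T a b c : ℝ}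
    (hψ : AbsolutelyContinuousOnInterval ψ 0 T) (ha : 0 ≤ a) (hab : a ≤ b) (hb : b ≤ T)
    {β : EuclideanSpace ℝ (Fin d)} (hc : ∀ s ∈ Ioc a b, hamiltonian P p (φ s) β ≤ c) :
    ENNReal.ofReal (inner ℝ β (ψ b - ψ a) - c * (b - a)) ≤
      ∫⁻ s in Ioc a b, (lagrangian P p (φ s) (deriv ψ s)).toENNReal := by
  have hsub : uIcc a b ⊆ uIcc 0 T := by
    rw [uIcc_of_le hab, uIcc_of_le (ha.trans (hab.trans hb))]
    exact Icc_subset_Icc ha hb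
  have hac := hψ.mono hsub
  have hf := hac.inner_left β
  have hint := hf.intervalIntegrable_deriv
  rw [intervalIntegrable_iff_integrableOn_Ioc_of_le hab] at hint
  have hFTC := hf.integral_deriv_eq_sub
  rw [intervalIntegral.integral_of_le hab] at hFTC
  have hval : ∫ s in Ioc a b, (deriv (fun s => inner ℝ β (ψ s)) s - c) =
      inner ℝ β (ψ b - ψ a) - c * (b - a) := by
    rw [integral_sub hint (integrable_const c), hFTC, inner_sub_right]
    simp [hab, mul_comm]
  rw [← hval]
  refine (ENNReal.ofReal_integral_le_lintegral_ofReal (hint.sub (integrable_const c))).trans ?_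
  refine setLIntegral_mono_ae' measurableSet_Ioc ?_
  filter_upwards [hac.ae_hasDerivAt] with s hs hsI
  have hd := (hasDerivAt_const s β).inner ℝ
    (hs (by rw [uIcc_of_le hab]; exact Ioc_subset_Icc_self hsI))
  simp only [inner_zero_left, add_zero] at hd
  change ENNReal.ofReal (deriv (fun t => inner ℝ β (ψ t)) s - c) ≤ _
  rw [hd.deriv, ← EReal.real_coe_toENNReal]
  refine EReal.toENNReal_le_toENNReal (le_trans ?_ (IsJumpModel.le_lagrangian _ _ β))
  exact EReal.coe_le_coe_iff.2 (by linarith [hc s hsI])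

/-- Since `H(x, β) ≤ ‖β‖`, the Lagrangian is infinite outside the unit ball. Testing with a large
multiple of the increment avoids any pointwise argument. -/
lemma norm_sub_le_of_lintegral_lagrangian_ne_top (M : IsJumpModel P p)
    {ψ φ : ℝ → EuclideanSpace ℝ (Fin d)} {T : ℝ} (hψ : AbsolutelyContinuousOnInterval ψ 0 T)
    (hJ : ∫⁻ s in Icc 0 T, (lagrangian P p (φ s) (deriv ψ s)).toENNReal ≠ ⊤) {a b : ℝ}
    (ha : 0 ≤ a) (hab : a ≤ b) (hb : b ≤ T) : ‖ψ b - ψ a‖ ≤ b - a := by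
  by_contra! hlt
  set u := ψ b - ψ a
  have hu : 0 < ‖u‖ := (sub_nonneg.2 hab).trans_lt hlt
  have hpos : 0 < ‖u‖ * (‖u‖ - (b - a)) := mul_pos hu (sub_pos.2 hlt)
  set J := ∫⁻ s in Icc 0 T, (lagrangian P p (φ s) (deriv ψ s)).toENNReal
  -- Chosen so that the lower bound on the action equals `J + 1`.
  set r := (J.toReal + 1) / (‖u‖ * (‖u‖ - (b - a)))
  have hr : 0 ≤ r := by positivity
  have h := ofReal_le_lintegral_lagrangian (P := P) (p := p) (φ := φ) (β := r • u)
    (c := r * ‖u‖) hψ ha hab hb fun s _ => by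
      simpa [norm_smul, abs_of_nonneg hr] using M.hamiltonian_le_norm (φ s) (r • u)
  have h2 := h.trans (lintegral_mono_set (t := Icc 0 T)
    ((Ioc_subset_Icc_self).trans (Icc_subset_Icc ha hb)))
  rw [ENNReal.ofReal_le_iff_le_toReal hJ, real_inner_smul_left, real_inner_self_eq_norm_sq] at h2
  have e : r * ‖u‖ ^ 2 - r * ‖u‖ * (b - a) = J.toReal + 1 := by
    have : r * (‖u‖ * (‖u‖ - (b - a))) = J.toReal + 1 := div_mul_cancel₀ _ hpos.ne'
    linarith
  change r * ‖u‖ ^ 2 - r * ‖u‖ * (b - a) ≤ J.toReal at h2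
  linarith

end Lagrangian

/-- The increment of `ψ - φ` is an integral of outward normals, whose product with `β` is
nonnegative. -/
lemma IsSkorokhodSolution.inner_sub_le {T : ℝ} {ψ φ : ℝ → EuclideanSpace ℝ (Fin d)}
    (h : IsSkorokhodSolution T ψ φ) {a b : ℝ} (ha : 0 ≤ a) (hab : a ≤ b) (hb : b ≤ T)
    {β : EuclideanSpace ℝ (Fin d)}
    (hβ : ∀ s ∈ Ioc a b, ∀ n ∈ outwardNormals (φ s), 0 ≤ inner ℝ β n) :
    inner ℝ β (φ b - φ a) ≤ inner ℝ β (ψ b - ψ a) := by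
  obtain ⟨-, -, -, m, n, hm, hn, hnormal, heq⟩ := h
  have hint : IntegrableOn n (Ioc 0 T) m := by
    refine Integrable.of_bound hn.restrict 1 ?_
    filter_upwards [hnormal] with s hs
    exact hs.1.le
  have hsub : Ioc a b ⊆ Ioc 0 T := Ioc_subset_Ioc ha hb
  have hsplit : ∫ s in Ioc 0 b, n s ∂m = ∫ s in Ioc 0 a, n s ∂m + ∫ s in Ioc a b, n s ∂m := by
    rw [← Ioc_union_Ioc_eq_Ioc ha hab]
    exact setIntegral_union (Set.Ioc_disjoint_Ioc_of_le le_rfl) measurableSet_Ioc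
      (hint.mono_set (Ioc_subset_Ioc_right (hab.trans hb))) (hint.mono_set hsub)
  have hk : 0 ≤ inner ℝ β (∫ s in Ioc a b, n s ∂m) := by
    rw [← integral_inner (hint.mono_set hsub)]
    refine integral_nonneg_of_ae ?_
    filter_upwards [ae_restrict_of_ae_restrict_of_subset hsub hnormal,
      ae_restrict_mem measurableSet_Ioc] with s hs hs'
    exact hβ s hs' _ hs
  rw [heq b ⟨ha.trans hab, hb⟩, heq a ⟨ha, hab.trans hb⟩, hsplit]
  rw [show φ b + (∫ s in Ioc 0 a, n s ∂m + ∫ s in Ioc a b, n s ∂m) -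
    (φ a + ∫ s in Ioc 0 a, n s ∂m) = (φ b - φ a) + ∫ s in Ioc a b, n s ∂m by abel, inner_add_right]
  linarith

/-- Each coordinate of the solution of the Skorokhod problem moves at most as fast as the
driving path. -/
lemma IsSkorokhodSolution.mul_coord_sub_le {T : ℝ} {ψ φ : ℝ → EuclideanSpace ℝ (Fin d)}
    (h : IsSkorokhodSolution T ψ φ)
    (hψ : ∀ a b, 0 ≤ a → a ≤ b → b ≤ T → ‖ψ b - ψ a‖ ≤ b - a) {a b : ℝ} (ha : 0 ≤ a)
    (hab : a ≤ b) (hb : b ≤ T) (l : Fin d) {σ : ℝ} (hσ : σ = 1 ∨ σ = -1) :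
    σ * (φ b l - φ a l) ≤ b - a := by
  have hφc : ContinuousOn (fun s => σ * φ s l) (Icc a b) :=
    continuousOn_const.mul ((by fun_prop : Continuous fun y : EuclideanSpace ℝ (Fin d) => y l)
      |>.comp_continuousOn (h.2.1.mono (Icc_subset_Icc ha hb)))
  have hcpt : IsCompact {s ∈ Icc a b | σ * φ s l ≤ σ * φ a l} := by
    have : {s ∈ Icc a b | σ * φ s l ≤ σ * φ a l} =
        Icc a b ∩ (fun s => σ * φ s l) ⁻¹' Iic (σ * φ a l) := rfl
    rw [this]
    exact isCompact_Icc.of_isClosed_subset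
      (hφc.preimage_isClosed_of_isClosed isClosed_Icc isClosed_Iic) inter_subset_left
  -- Let `u` be the last time at which `σ φ_l` is at most its value at `a`. After `u` the coordinate
  -- is off the face where `σ n_l` could be negative, so on `[u, b]` the increment of `σ φ_l` is at
  -- most that of `σ ψ_l`.
  obtain ⟨u, ⟨hu, hu'⟩, hmax⟩ := hcpt.exists_isGreatest ⟨a, ⟨le_rfl, hab⟩, le_rfl⟩
  have hcube := h.2.2.1
  have key := h.inner_sub_le (ha.trans hu.1) hu.2 hb (β := EuclideanSpace.single l σ) ?_
  · have h2 : inner ℝ (EuclideanSpace.single l σ) (ψ b - ψ u) ≤ b - u := by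
      refine (real_inner_le_norm _ _).trans ?_
      have : ‖EuclideanSpace.single l σ‖ = 1 := by rcases hσ with rfl | rfl <;> simp
      rw [this, one_mul]
      exact hψ u b (ha.trans hu.1) hu.2 hb
    simp only [EuclideanSpace.inner_single_left, PiLp.sub_apply, conj_trivial] at key h2
    have := hu.1
    linarith
  · intro s hs n hn
    have hsT : s ∈ Icc 0 T := ⟨ha.trans (hu.1.trans hs.1.le), hs.2.trans hb⟩
    have hgt : σ * φ a l < σ * φ s l := by
      by_contra! hle
      exact absurd (hmax ⟨⟨hu.1.trans hs.1.le, hs.2⟩, hle⟩) (not_le.2 hs.1)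
    have h0 := hcube (show a ∈ Icc 0 T from ⟨ha, hab.trans hb⟩) l
    have h1 := hcube hsT l
    obtain ⟨hn0, hn1, hn2⟩ := hn.2 l
    simp only [EuclideanSpace.inner_single_left, conj_trivial]
    rcases hσ with rfl | rfl
    · rcases h1.2.lt_or_eq with h3 | h3
      · rw [hn0 ⟨by linarith [h0.1], h3⟩, mul_zero]
      · linarith [hn2 h3]
    · rcases h1.1.lt_or_eq with h3 | h3
      · rw [hn0 ⟨h3, by linarith [h0.2]⟩, mul_zero]
      · linarith [hn1 h3.symm]

lemma IsSkorokhodSolution.norm_sub_le {T : ℝ} {ψ φ : ℝ → EuclideanSpace ℝ (Fin d)}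
    (h : IsSkorokhodSolution T ψ φ)
    (hψ : ∀ a b, 0 ≤ a → a ≤ b → b ≤ T → ‖ψ b - ψ a‖ ≤ b - a) {a b : ℝ} (ha : 0 ≤ a)
    (hab : a ≤ b) (hb : b ≤ T) : ‖φ b - φ a‖ ≤ √d * (b - a) := by
  have hc : ∀ l, |φ b l - φ a l| ≤ b - a := fun l => by
    have h1 := h.mul_coord_sub_le hψ ha hab hb l (Or.inl rfl)
    have h2 := h.mul_coord_sub_le hψ ha hab hb l (Or.inr rfl)
    exact abs_le.2 ⟨by linarith, by linarith⟩
  rw [EuclideanSpace.norm_eq]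
  refine Real.sqrt_le_iff.2 ⟨mul_nonneg (Real.sqrt_nonneg _) (sub_nonneg.2 hab), ?_⟩
  rw [mul_pow, Real.sq_sqrt d.cast_nonneg]
  calc ∑ l, ‖(φ b - φ a) l‖ ^ 2 ≤ ∑ _l : Fin d, (b - a) ^ 2 :=
        Finset.sum_le_sum fun l _ => pow_le_pow_left₀ (norm_nonneg _) (hc l) 2
    _ = d * (b - a) ^ 2 := by simp

lemma IsSkorokhodSolution.mono {T τ : ℝ} {ψ φ : ℝ → EuclideanSpace ℝ (Fin d)}
    (h : IsSkorokhodSolution T ψ φ) (hτ : τ ≤ T) : IsSkorokhodSolution τ ψ φ := by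
  obtain ⟨h1, h2, h3, m, n, hm, hn, hnormal, heq⟩ := h
  have hs : Icc 0 τ ⊆ Icc 0 T := Icc_subset_Icc_right hτ
  exact ⟨h1.mono hs, h2.mono hs, h3.mono_left hs, m, n, hm, hn,
    ae_restrict_of_ae_restrict_of_subset (Ioc_subset_Ioc_right hτ) hnormal,
    fun t ht => heq t (hs ht)⟩

section QuasiPotential

variable {E : Type*} [Fintype E] [Nonempty E] {P : Matrix E E ℝ}
  {p : EuclideanSpace ℝ (Fin d) → E → Fin d × ℤˣ → ℝ}

lemma quasiPotential_le {x y : EuclideanSpace ℝ (Fin d)} {T : ℝ} (hT : 0 < T)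
    {ψ φ : ℝ → EuclideanSpace ℝ (Fin d)} (hψ : AbsolutelyContinuousOnInterval ψ 0 T)
    (h : IsSkorokhodSolution T ψ φ) (h0 : φ 0 = x) (h1 : φ T = y) :
    quasiPotential P p x y ≤
      ∫⁻ s in Icc 0 T, (lagrangian P p (φ s) (deriv ψ s)).toENNReal :=
  iInf_le_of_le T <| iInf_le_of_le hT <| iInf_le_of_le φ <| iInf_le_of_le h.2.2.1 <|
    iInf_le_of_le h0 <| iInf_le_of_le h1 <| iInf_le_of_le ψ <| iInf_le_of_le hψ <|
      iInf_le_of_le h le_rfl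

lemma exists_path_of_quasiPotential_lt {x y : EuclideanSpace ℝ (Fin d)} {a : ENNReal}
    (h : quasiPotential P p x y < a) :
    ∃ T : ℝ, 0 < T ∧ ∃ ψ φ : ℝ → EuclideanSpace ℝ (Fin d),
      AbsolutelyContinuousOnInterval ψ 0 T ∧ IsSkorokhodSolution T ψ φ ∧ φ 0 = x ∧ φ T = y ∧
        ∫⁻ s in Icc 0 T, (lagrangian P p (φ s) (deriv ψ s)).toENNReal < a := by
  simp only [quasiPotential, action, iInf_lt_iff] at h
  obtain ⟨T, hT, φ, -, h0, h1, ψ, hψ, hS, hlt⟩ := h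
  exact ⟨T, hT, ψ, φ, hψ, hS, h0, h1, hlt⟩

end QuasiPotential

end Paths

/-! ### Continuing paths by straight pieces; finiteness of the quasi-potential. -/

section Extension

variable {d : ℕ}

/-- The path `φ` stopped at time `T` and continued with constant velocity `w`. -/
noncomputable def extendLinearly (T : ℝ) (φ : ℝ → EuclideanSpace ℝ (Fin d))
    (w : EuclideanSpace ℝ (Fin d)) (s : ℝ) : EuclideanSpace ℝ (Fin d) :=
  φ (min s T) + max (s - T) 0 • w

lemma extendLinearly_of_le {T s : ℝ} (h : s ≤ T) (φ : ℝ → EuclideanSpace ℝ (Fin d))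
    (w : EuclideanSpace ℝ (Fin d)) : extendLinearly T φ w s = φ s := by
  simp [extendLinearly, h]

lemma extendLinearly_of_ge {T s : ℝ} (h : T ≤ s) (φ : ℝ → EuclideanSpace ℝ (Fin d))
    (w : EuclideanSpace ℝ (Fin d)) : extendLinearly T φ w s = φ T + (s - T) • w := by
  simp [extendLinearly, h]

lemma deriv_extendLinearly_of_lt {T s : ℝ} (h : s < T) (φ : ℝ → EuclideanSpace ℝ (Fin d))
    (w : EuclideanSpace ℝ (Fin d)) : deriv (extendLinearly T φ w) s = deriv φ s :=
  Filter.EventuallyEq.deriv_eq <| by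
    filter_upwards [Iio_mem_nhds h] with r hr
    exact extendLinearly_of_le (le_of_lt hr) φ w

lemma deriv_extendLinearly_of_gt {T s : ℝ} (h : T < s) (φ : ℝ → EuclideanSpace ℝ (Fin d))
    (w : EuclideanSpace ℝ (Fin d)) : deriv (extendLinearly T φ w) s = w := by
  have h1 : extendLinearly T φ w =ᶠ[𝓝 s] fun r => φ T + (r - T) • w := by
    filter_upwards [Ioi_mem_nhds h] with r hr
    exact extendLinearly_of_ge (le_of_lt hr) φ w
  rw [h1.deriv_eq]
  simpa using ((((hasDerivAt_id s).sub_const T).smul_const w).const_add (φ T)).deriv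

lemma continuousOn_extendLinearly {T t : ℝ} (hT : 0 ≤ T) {φ : ℝ → EuclideanSpace ℝ (Fin d)}
    (hφ : ContinuousOn φ (Icc 0 T)) (w : EuclideanSpace ℝ (Fin d)) :
    ContinuousOn (extendLinearly T φ w) (Icc 0 (T + t)) := by
  refine ContinuousOn.add (hφ.comp (by fun_prop) fun s hs => ?_) (by fun_prop)
  exact ⟨le_min hs.1 hT, min_le_right _ _⟩

lemma absolutelyContinuousOnInterval_extendLinearly {T t : ℝ} (hT : 0 ≤ T) (ht : 0 ≤ t)
    {ψ : ℝ → EuclideanSpace ℝ (Fin d)}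
    (hψ : ∀ a b, 0 ≤ a → a ≤ b → b ≤ T → ‖ψ b - ψ a‖ ≤ b - a) (v : EuclideanSpace ℝ (Fin d)) :
    AbsolutelyContinuousOnInterval (extendLinearly T ψ v) 0 (T + t) := by
  have hlip : LipschitzOnWith 1 ψ (Icc 0 T) := by
    refine LipschitzOnWith.of_dist_le_mul fun a ha b hb => ?_
    rw [NNReal.coe_one, one_mul, dist_eq_norm, Real.dist_eq]
    rcases le_total b a with h | h
    · exact (hψ b a hb.1 h ha.2).trans (le_abs_self _)
    · rw [norm_sub_rev, abs_sub_comm]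
      exact (hψ a b ha.1 h hb.2).trans (le_abs_self _)
  refine AbsolutelyContinuousOnInterval.add ?_ ?_
  · refine LipschitzOnWith.absolutelyContinuousOnInterval (K := 1 * 1) (hlip.comp
      ((LipschitzWith.id.min_const T).lipschitzOnWith) fun s hs => ?_)
    rw [uIcc_of_le (add_nonneg hT ht)] at hs
    exact ⟨le_min hs.1 hT, min_le_right _ _⟩
  · have h1 : LipschitzWith 1 fun s : ℝ => max (s - T) 0 :=
      (LipschitzWith.of_dist_le_mul fun a b => by simp).max_const 0
    have h2 : LipschitzWith (‖v‖₊ * 1) fun s : ℝ => max (s - T) 0 • v :=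
      LipschitzWith.comp (g := fun s : ℝ => max (s - T) 0) (f := fun r : ℝ => r • v)
        (LipschitzWith.of_dist_le_mul fun a b => by
          rw [dist_eq_norm, ← sub_smul, norm_smul, mul_comm, Real.dist_eq, Real.norm_eq_abs]
          rfl) h1
    exact h2.lipschitzOnWith.absolutelyContinuousOnInterval

/-- On `(T, T + t]` the reflection term is continued by `c` times Lebesgue measure with constant
normal `N`. For `c = 0` there is no reflection and `N` is arbitrary. -/
lemma isSkorokhodSolution_extendLinearly {T t c : ℝ} (hT : 0 ≤ T) (hc : 0 ≤ c)
    {ψ φ : ℝ → EuclideanSpace ℝ (Fin d)} (h : IsSkorokhodSolution T ψ φ)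
    {v w N : EuclideanSpace ℝ (Fin d)} (hvw : v = w + c • N)
    (hcube : ∀ s ∈ Icc 0 t, φ T + s • w ∈ cube d)
    (hN : 0 < c → ∀ s ∈ Icc 0 t, N ∈ outwardNormals (φ T + s • w)) :
    IsSkorokhodSolution (T + t) (extendLinearly T ψ v) (extendLinearly T φ w) := by
  obtain ⟨hψc, hφc, hmaps, m, n, hm, hn, hnormal, heq⟩ := h
  set n' : ℝ → EuclideanSpace ℝ (Fin d) := fun s => if s ≤ T then n s else N
  have hn1 : ∀ s ∈ Ioc 0 T, n' s = n s := fun s hs => if_pos hs.2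
  have hn2 : ∀ s ∈ Ioc T (T + t), n' s = N := fun s hs => if_neg (not_le.2 hs.1)
  set m₁ := m.restrict (Ioc 0 T)
  set m₂ : Measure ℝ := ENNReal.ofReal c • (volume.restrict (Ioc T (T + t)))
  have hae1 : n' =ᵐ[m₁] n := by
    filter_upwards [ae_restrict_mem measurableSet_Ioc] with s hs using hn1 s hs
  have hae2' : n' =ᵐ[volume.restrict (Ioc T (T + t))] fun _ => N := by
    filter_upwards [ae_restrict_mem measurableSet_Ioc] with s hs using hn2 s hs
  have hae2 : n' =ᵐ[m₂] fun _ => N := Measure.ae_smul_measure hae2' _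
  have hfin2 : IsFiniteMeasure m₂ := Measure.smul_finite _ ENNReal.ofReal_ne_top
  have hint1 : Integrable n' m₁ := by
    refine Integrable.congr (Integrable.of_bound hn.restrict 1 ?_) hae1.symm
    filter_upwards [hnormal] with s hs
    exact hs.1.le
  have hint2 : Integrable n' m₂ := (integrable_const N).congr hae2.symm
  refine ⟨continuousOn_extendLinearly hT hψc v, continuousOn_extendLinearly hT hφc w, ?_,
    m₁ + m₂, n', inferInstance, ?_, ?_, ?_⟩
  · intro s hs
    rcases le_total s T with h | h
    · rw [extendLinearly_of_le h]
      exact hmaps ⟨hs.1, h⟩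
    · rw [extendLinearly_of_ge h]
      exact hcube _ ⟨by linarith, by linarith [hs.2]⟩
  · exact aestronglyMeasurable_add_measure_iff.2
      ⟨hint1.aestronglyMeasurable, hint2.aestronglyMeasurable⟩
  · refine ae_restrict_of_ae (ae_add_measure_iff.2 ⟨?_, ?_⟩)
    · filter_upwards [hnormal, hae1, ae_restrict_mem measurableSet_Ioc] with s h1 h2 h3
      rwa [h2, extendLinearly_of_le h3.2]
    · rcases hc.eq_or_lt with rfl | hc'
      · simp [m₂]
      · refine Measure.ae_smul_measure ?_ _
        filter_upwards [ae_restrict_mem measurableSet_Ioc] with s hs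
        rw [hn2 s hs, extendLinearly_of_ge hs.1.le]
        exact hN hc' _ ⟨by linarith [hs.1], by linarith [hs.2]⟩
  · intro r hr
    have hmin : min r T ∈ Icc 0 T := ⟨le_min hr.1 hT, min_le_right _ _⟩
    have i1 : ∫ s in Ioc 0 r, n' s ∂m₁ = ∫ s in Ioc 0 (min r T), n s ∂m := by
      rw [Measure.restrict_restrict measurableSet_Ioc, Ioc_inter_Ioc, max_self]
      exact setIntegral_congr_fun measurableSet_Ioc fun s hs =>
        hn1 s ⟨hs.1, hs.2.trans (min_le_right _ _)⟩
    have i2 : ∫ s in Ioc 0 r, n' s ∂m₂ = (c * max (r - T) 0) • N := by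
      rw [Measure.restrict_smul, integral_smul_measure, ENNReal.toReal_ofReal hc,
        Measure.restrict_restrict measurableSet_Ioc, Ioc_inter_Ioc, max_eq_right hT,
        min_eq_left hr.2, setIntegral_congr_fun (g := fun _ => N) measurableSet_Ioc fun s hs =>
          hn2 s ⟨hs.1, hs.2.trans hr.2⟩, setIntegral_const, Real.volume_real_Ioc, smul_smul]
    rw [Measure.restrict_add, integral_add_measure hint1.restrict hint2.restrict, i1, i2,
      extendLinearly, extendLinearly, heq _ hmin, hvw, smul_add, smul_smul, mul_comm c]
    abel

variable {E : Type*} [Fintype E] [Nonempty E] {P : Matrix E E ℝ}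
  {p : EuclideanSpace ℝ (Fin d) → E → Fin d × ℤˣ → ℝ}

lemma lintegral_lagrangian_extendLinearly_le {T t : ℝ} (hT : 0 ≤ T) (ht : 0 ≤ t)
    (ψ φ : ℝ → EuclideanSpace ℝ (Fin d)) {v w : EuclideanSpace ℝ (Fin d)} {B : ℝ}
    (hB : ∀ s ∈ Icc 0 t, lagrangian P p (φ T + s • w) v ≤ B) :
    ∫⁻ s in Icc 0 (T + t), (lagrangian P p (extendLinearly T φ w s)
        (deriv (extendLinearly T ψ v) s)).toENNReal ≤
      (∫⁻ s in Icc 0 T, (lagrangian P p (φ s) (deriv ψ s)).toENNReal) + ENNReal.ofReal (B * t) := by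
  rw [← Icc_union_Ioc_eq_Icc hT (by linarith : T ≤ T + t),
    lintegral_union measurableSet_Ioc
      (show Disjoint (Icc 0 T) (Ioc T (T + t)) from
        Set.disjoint_left.2 fun s h1 h2 => not_lt.2 h1.2 h2.1)]
  refine add_le_add (le_of_eq ?_) ?_
  -- The endpoints are dropped because the derivative at `T` may change under the extension.
  · rw [← setLIntegral_congr Ioo_ae_eq_Icc, ← setLIntegral_congr Ioo_ae_eq_Icc]
    refine setLIntegral_congr_fun measurableSet_Ioo fun s hs => ?_
    simp only [extendLinearly_of_le hs.2.le, deriv_extendLinearly_of_lt hs.2]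
  · calc ∫⁻ s in Ioc T (T + t), (lagrangian P p (extendLinearly T φ w s)
          (deriv (extendLinearly T ψ v) s)).toENNReal
        ≤ ∫⁻ _s in Ioc T (T + t), ENNReal.ofReal B := by
          refine setLIntegral_mono' measurableSet_Ioc fun s hs => ?_
          rw [extendLinearly_of_ge hs.1.le, deriv_extendLinearly_of_gt hs.1,
            ← EReal.real_coe_toENNReal]
          exact EReal.toENNReal_le_toENNReal (hB _ ⟨by linarith [hs.1], by linarith [hs.2]⟩)
      _ = ENNReal.ofReal (B * t) := by
          rw [setLIntegral_const, Real.volume_Ioc, add_sub_cancel_left, ENNReal.ofReal_mul' ht]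

/-- Extending paths by a straight piece driven by `v` and reflected to have velocity `w`. -/
lemma IsJumpModel.quasiPotential_add_smul_le (M : IsJumpModel P p)
    {x₀ x v w N : EuclideanSpace ℝ (Fin d)} {t c B : ℝ} (ht : 0 ≤ t) (hc : 0 ≤ c)
    (hvw : v = w + c • N) (hcube : ∀ s ∈ Icc 0 t, x + s • w ∈ cube d)
    (hN : 0 < c → ∀ s ∈ Icc 0 t, N ∈ outwardNormals (x + s • w))
    (hB : ∀ s ∈ Icc 0 t, lagrangian P p (x + s • w) v ≤ B) :
    quasiPotential P p x₀ (x + t • w) ≤ quasiPotential P p x₀ x + ENNReal.ofReal (B * t) := by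
  by_contra! hlt
  -- The strict inequality leaves room for a path to `x` whose action plus `B t` is still below the
  -- quasi-potential at the new endpoint. Its action is finite, so `ψ` is 1-Lipschitz, as the
  -- extension requires.
  obtain ⟨T, hT, ψ, φ, hψ, hS, h0, rfl, hJ⟩ := exists_path_of_quasiPotential_lt
    (lt_tsub_iff_right.2 hlt)
  have hlip : ∀ a b, 0 ≤ a → a ≤ b → b ≤ T → ‖ψ b - ψ a‖ ≤ b - a := fun a b ha hab hb =>
    norm_sub_le_of_lintegral_lagrangian_ne_top M hψ (hJ.trans_le le_top).ne ha hab hb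
  have h1 := quasiPotential_le (P := P) (p := p) (by linarith : 0 < T + t)
    (absolutelyContinuousOnInterval_extendLinearly hT.le ht hlip v)
    (isSkorokhodSolution_extendLinearly hT.le hc hS hvw hcube hN)
    (x := x₀) (y := φ T + t • w) (by rw [extendLinearly_of_le hT.le, h0])
    (by rw [extendLinearly_of_ge (by linarith), add_sub_cancel_left])
  have h2 := lintegral_lagrangian_extendLinearly_le (P := P) (p := p) hT.le ht ψ φ hB
  exact absurd (lt_tsub_iff_right.1 hJ) (not_lt.2 (h1.trans h2))

lemma IsJumpModel.quasiPotential_self_ne_top (M : IsJumpModel P p) :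
    quasiPotential P p 0 0 ≠ ⊤ := by
  obtain ⟨C, -, hC⟩ := M.exists_abs_le_hamiltonian_add
  obtain ⟨l, -⟩ := M.nonempty_index
  have hS : IsSkorokhodSolution 1 (fun _ => (0 : EuclideanSpace ℝ (Fin d))) (fun _ => 0) :=
    ⟨continuousOn_const, continuousOn_const, fun _ _ => zero_mem_cube, 0, fun _ => 0,
      inferInstance, aestronglyMeasurable_zero_measure _, by simp, by simp⟩
  have hac : AbsolutelyContinuousOnInterval (fun _ => (0 : EuclideanSpace ℝ (Fin d))) 0 1 :=
    (LipschitzWith.const 0).lipschitzOnWith.absolutelyContinuousOnInterval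
  have hL : lagrangian P p (0 : EuclideanSpace ℝ (Fin d)) 0 ≤ (C : ℝ) :=
    IsJumpModel.lagrangian_le fun β => by
      rw [inner_zero_right]
      linarith [hC 0 zero_mem_cube β l, abs_nonneg (β l)]
  refine ((quasiPotential_le one_pos hac hS rfl rfl).trans_lt ?_).ne
  simp only [deriv_const, setLIntegral_const]
  refine ENNReal.mul_lt_top ?_ measure_Icc_lt_top
  refine (EReal.toENNReal_le_toENNReal hL).trans_lt ?_
  simp

lemma IsJumpModel.quasiPotential_ne_top (M : IsJumpModel P p) {x : EuclideanSpace ℝ (Fin d)}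
    (hx : x ∈ cube d) : quasiPotential P p 0 x ≠ ⊤ := by
  obtain ⟨C, -, hC⟩ := M.exists_abs_le_hamiltonian_add
  obtain ⟨l₀, -⟩ := M.nonempty_index
  have hd : (0 : ℝ) < d := Nat.cast_pos.2 (Fin.pos l₀)
  have hcube : ∀ s ∈ Icc (0 : ℝ) d, (0 : EuclideanSpace ℝ (Fin d)) + s • ((d : ℝ)⁻¹ • x) ∈
      cube d := by
    intro s hs l
    have h1 : 0 ≤ s * (d : ℝ)⁻¹ := mul_nonneg hs.1 (inv_pos.2 hd).le
    have h2 : s * (d : ℝ)⁻¹ ≤ 1 := by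
      rw [← div_eq_mul_inv]; exact (div_le_one hd).2 hs.2
    simp only [zero_add, smul_smul, PiLp.smul_apply, smul_eq_mul]
    exact ⟨mul_nonneg h1 (hx l).1, mul_le_one₀ h2 (hx l).1 (hx l).2⟩
  -- The segment from `0` to `x` is run in time `d`: for the velocity `x / d`, averaging the `d`
  -- coordinate bounds `|β_l| ≤ H + C` gives `L ≤ C`.
  have h := M.quasiPotential_add_smul_le (x₀ := 0) (x := 0) (v := (d : ℝ)⁻¹ • x)
    (w := (d : ℝ)⁻¹ • x) (N := 0) (t := d) (c := 0) (B := C) hd.le le_rfl (by simp) hcube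
    (by simp) fun s hs => IsJumpModel.lagrangian_le fun β => by
      have hβ := hC _ (hcube s hs) β
      rw [inner_smul_right, PiLp.inner_apply]
      have : ∑ l, inner ℝ (β l) (x l) ≤
          ∑ _l : Fin d, (hamiltonian P p (0 + s • ((d : ℝ)⁻¹ • x)) β + C) := by
        refine Finset.sum_le_sum fun l _ => ?_
        calc inner ℝ (β l) (x l) = x l * β l := by simp
          _ ≤ x l * |β l| := mul_le_mul_of_nonneg_left (le_abs_self _) (hx l).1
          _ ≤ |β l| := mul_le_of_le_one_left (abs_nonneg _) (hx l).2
          _ ≤ _ := hβ l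
      rw [Finset.sum_const, Finset.card_univ, Fintype.card_fin, nsmul_eq_mul] at this
      have h3 := mul_le_mul_of_nonneg_left this (inv_pos.2 hd).le
      rw [inv_mul_cancel_left₀ hd.ne'] at h3
      linarith
  rw [smul_inv_smul₀ hd.ne', zero_add] at h
  exact (h.trans_lt (ENNReal.add_lt_top.2
    ⟨M.quasiPotential_self_ne_top.lt_top, ENNReal.ofReal_lt_top⟩)).ne

end Extension

/-! ### Viscosity inequalities in the interior and on the boundary. -/

section Viscosity

variable {d : ℕ}

lemma convex_cube : Convex ℝ (cube d) := by
  intro x hx y hy a b ha hb hab l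
  exact convex_Icc (0 : ℝ) 1 (hx l) (hy l) ha hb hab

lemma isOpen_openCube : IsOpen (openCube d) := by
  have : openCube d = ⋂ l, {x : EuclideanSpace ℝ (Fin d) | x l ∈ Ioo (0 : ℝ) 1} := by
    ext; simp [openCube]
  rw [this]
  exact isOpen_iInter_of_finite fun l => isOpen_Ioo.preimage (by fun_prop)

lemma add_smul_mem_cube {x w : EuclideanSpace ℝ (Fin d)} {s t : ℝ} (ht : 0 < t)
    (hx : x ∈ cube d) (hy : x + t • w ∈ cube d) (hs : s ∈ Icc 0 t) : x + s • w ∈ cube d := by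
  have h := convex_cube.add_smul_mem hx hy
    (t := s / t) ⟨div_nonneg hs.1 ht.le, (div_le_one ht).2 hs.2⟩
  rwa [smul_smul, div_mul_cancel₀ _ ht.ne'] at h

lemma tendsto_add_smul_nhdsWithin {S : Set (EuclideanSpace ℝ (Fin d))}
    {x w : EuclideanSpace ℝ (Fin d)} (h : ∀ᶠ t : ℝ in 𝓝[>] 0, x + t • w ∈ S) :
    Tendsto (fun t : ℝ => x + t • w) (𝓝[>] 0) (𝓝[S] x) := by
  refine tendsto_nhdsWithin_iff.2 ⟨?_, h⟩
  have : Tendsto (fun t : ℝ => x + t • w) (𝓝 0) (𝓝 (x + (0 : ℝ) • w)) :=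
    Continuous.tendsto (by fun_prop) 0
  rw [zero_smul, add_zero] at this
  exact this.mono_left nhdsWithin_le_nhds

lemma HasGradientWithinAt.tendsto_slope {S : Set (EuclideanSpace ℝ (Fin d))}
    {θ : EuclideanSpace ℝ (Fin d) → ℝ} {x α w : EuclideanSpace ℝ (Fin d)}
    (hθ : HasGradientWithinAt θ α S x) (h : ∀ᶠ t : ℝ in 𝓝[>] 0, x + t • w ∈ S) :
    Tendsto (fun t : ℝ => t⁻¹ * (θ (x + t • w) - θ x)) (𝓝[>] 0) (𝓝 (inner ℝ α w)) := by
  have h0 : Tendsto (fun t : ℝ => t • w) (𝓝[>] 0) (𝓝 0) := by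
    have : Tendsto (fun t : ℝ => t • w) (𝓝 0) (𝓝 ((0 : ℝ) • w)) :=
      Continuous.tendsto (by fun_prop) 0
    rw [zero_smul] at this
    exact this.mono_left nhdsWithin_le_nhds
  have := hθ.hasFDerivWithinAt.lim (c := fun t => t⁻¹) (d := fun t => t • w)
    (v := w) h0 h ?_
  · simpa using this
  · refine tendsto_const_nhds.congr' ?_
    filter_upwards [self_mem_nhdsWithin] with t ht
    rw [inv_smul_smul₀ (ne_of_gt ht)]

/-- If `y` lies on no face other than those containing `x`, its normals satisfy every constraint
imposed at `x`. Hence a sign condition on the normals at `x` persists nearby. -/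
lemma outwardNormals_subset_of_near {x y : EuclideanSpace ℝ (Fin d)} (hy : y ∈ cube d)
    (h : ∀ l, (x l < 1 → y l < 1) ∧ (0 < x l → 0 < y l)) :
    outwardNormals y ⊆ outwardNormals x := by
  rintro n ⟨hn, hnl⟩
  refine ⟨hn, fun l => ?_⟩
  obtain ⟨h0, h1, h2⟩ := hnl l
  obtain ⟨h3, h4⟩ := h l
  refine ⟨fun hl => h0 ⟨h4 hl.1, h3 hl.2⟩, fun hl => ?_, fun hl => ?_⟩
  · rcases (hy l).1.lt_or_eq with h5 | h5
    · exact (h0 ⟨h5, h3 (by rw [hl]; exact one_pos)⟩).le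
    · exact h1 h5.symm
  · rcases (hy l).2.lt_or_eq with h5 | h5
    · exact (h0 ⟨h4 (by rw [hl]; exact one_pos), h5⟩).ge
    · exact h2 h5

lemma eventually_outwardNormals_subset (x : EuclideanSpace ℝ (Fin d)) :
    ∀ᶠ y in 𝓝[cube d] x, outwardNormals y ⊆ outwardNormals x := by
  have hcoord : ∀ l : Fin d, Continuous fun y : EuclideanSpace ℝ (Fin d) => y l := fun l => by
    fun_prop
  have h : ∀ᶠ y in 𝓝 x, ∀ l, (x l < 1 → y l < 1) ∧ (0 < x l → 0 < y l) := by
    refine eventually_all.2 fun l => Filter.Eventually.and ?_ ?_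
    · by_cases hl : x l < 1
      · filter_upwards [(hcoord l).continuousAt.eventually_lt continuousAt_const hl]
          with y hy _ using hy
      · exact Eventually.of_forall fun _ h => absurd h hl
    · by_cases hl : 0 < x l
      · filter_upwards [continuousAt_const.eventually_lt (hcoord l).continuousAt hl]
          with y hy _ using hy
      · exact Eventually.of_forall fun _ h => absurd h hl
  filter_upwards [h.filter_mono nhdsWithin_le_nhds, self_mem_nhdsWithin] with y h1 h2
  exact outwardNormals_subset_of_near h2 h1

/-- The velocity in the cube at `x` of a path driven with velocity `v`. -/
noncomputable def reflectedVelocity (x v : EuclideanSpace ℝ (Fin d)) :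
    EuclideanSpace ℝ (Fin d) :=
  WithLp.toLp 2 fun l => if (x l = 0 ∧ v l < 0) ∨ (x l = 1 ∧ 0 < v l) then 0 else v l

lemma eventually_add_smul_reflectedVelocity_mem {x : EuclideanSpace ℝ (Fin d)}
    (hx : x ∈ cube d) (v : EuclideanSpace ℝ (Fin d)) :
    ∀ᶠ t : ℝ in 𝓝[>] 0, x + t • reflectedVelocity x v ∈ cube d := by
  refine eventually_all.2 fun l => ?_
  set w := reflectedVelocity x v
  have hlim : Tendsto (fun t : ℝ => x l + t * w l) (𝓝[>] 0) (𝓝 (x l)) := by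
    have : Tendsto (fun t : ℝ => x l + t * w l) (𝓝 0) (𝓝 (x l + 0 * w l)) :=
      Continuous.tendsto (by fun_prop) 0
    rw [zero_mul, add_zero] at this
    exact this.mono_left nhdsWithin_le_nhds
  have hw : w l = if (x l = 0 ∧ v l < 0) ∨ (x l = 1 ∧ 0 < v l) then 0 else v l := rfl
  have lower : ∀ᶠ t : ℝ in 𝓝[>] 0, 0 ≤ x l + t * w l := by
    rcases (hx l).1.lt_or_eq with h | h
    · filter_upwards [hlim.eventually_const_lt h] with t ht using ht.le
    · have hwl : 0 ≤ w l := by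
        rw [hw]
        split_ifs with hcase
        · exact le_rfl
        · by_contra! hneg
          exact hcase (Or.inl ⟨h.symm, hneg⟩)
      filter_upwards [self_mem_nhdsWithin] with t ht
      exact add_nonneg (hx l).1 (mul_nonneg (le_of_lt ht) hwl)
  have upper : ∀ᶠ t : ℝ in 𝓝[>] 0, x l + t * w l ≤ 1 := by
    rcases (hx l).2.lt_or_eq with h | h
    · filter_upwards [hlim.eventually_lt_const h] with t ht using ht.le
    · have hwl : w l ≤ 0 := by
        rw [hw]
        split_ifs with hcase
        · exact le_rfl
        · by_contra! hneg
          exact hcase (Or.inr ⟨h, hneg⟩)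
      filter_upwards [self_mem_nhdsWithin] with t ht
      have := mul_nonpos_of_nonneg_of_nonpos (le_of_lt ht) hwl
      linarith
  filter_upwards [lower, upper] with t h1 h2
  exact ⟨h1, h2⟩

lemma exists_outwardNormal_reflectedVelocity {x : EuclideanSpace ℝ (Fin d)}
    (v : EuclideanSpace ℝ (Fin d)) :
    ∃ (c : ℝ) (N : EuclideanSpace ℝ (Fin d)), 0 ≤ c ∧ v = reflectedVelocity x v + c • N ∧
      (0 < c → ∀ s : ℝ, N ∈ outwardNormals (x + s • reflectedVelocity x v)) := by
  set w := reflectedVelocity x v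
  -- The difference `v - w` lives on the suppressed coordinates. There `w` vanishes, so the path
  -- stays on those faces and `N` remains an outward normal along the whole line.
  refine ⟨‖v - w‖, ‖v - w‖⁻¹ • (v - w), norm_nonneg _, ?_, fun hc s => ⟨?_, fun l => ?_⟩⟩
  · rcases eq_or_ne (‖v - w‖) 0 with h | h
    · rw [h, zero_smul, add_zero]
      exact sub_eq_zero.1 (norm_eq_zero.1 h)
    · rw [smul_inv_smul₀ h, add_sub_cancel]
  · rw [norm_smul, norm_inv, norm_norm, inv_mul_cancel₀ hc.ne']
  · have hw : w l = if (x l = 0 ∧ v l < 0) ∨ (x l = 1 ∧ 0 < v l) then 0 else v l := rfl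
    have hinv := (inv_pos.2 hc).le
    simp only [PiLp.add_apply, PiLp.smul_apply, PiLp.sub_apply, smul_eq_mul]
    split_ifs at hw with hcase
    · rw [hw, mul_zero, add_zero, sub_zero]
      rcases hcase with ⟨h1, h2⟩ | ⟨h1, h2⟩
      · exact ⟨fun h => absurd h1 h.1.ne', fun _ => mul_nonpos_of_nonneg_of_nonpos hinv h2.le,
          fun h => by linarith⟩
      · exact ⟨fun h => absurd h1 h.2.ne, fun h => by linarith, fun _ => mul_nonneg hinv h2.le⟩
    · simp [hw]

/-- `τ` is the last time at which `g ≥ r`; a value above `r` there would produce a later crossing by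
the intermediate value theorem. -/
lemma exists_last_exit {g : ℝ → ℝ} {T r : ℝ} (hT : 0 ≤ T) (hg : ContinuousOn g (Icc 0 T))
    (h0 : r < g 0) (h1 : g T < r) :
    ∃ τ ∈ Ioo 0 T, g τ = r ∧ ∀ s ∈ Ioc τ T, g s ≤ r := by
  have hcpt : IsCompact (Icc 0 T ∩ g ⁻¹' Ici r) :=
    isCompact_Icc.of_isClosed_subset (hg.preimage_isClosed_of_isClosed isClosed_Icc isClosed_Ici)
      inter_subset_left
  obtain ⟨τ, ⟨hτ, hτ'⟩, hmax⟩ := hcpt.exists_isGreatest ⟨0, ⟨le_rfl, hT⟩, h0.le⟩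
  have heq : g τ = r := by
    by_contra hne
    obtain ⟨s, hs, hsr⟩ := intermediate_value_Icc' hτ.2 (hg.mono (Icc_subset_Icc_left hτ.1))
      (show r ∈ Icc (g T) (g τ) from ⟨h1.le, hτ'⟩)
    have : s = τ := le_antisymm (hmax ⟨⟨hτ.1.trans hs.1, hs.2⟩, hsr.ge⟩) hs.1
    exact hne (this ▸ hsr)
  refine ⟨τ, ⟨lt_of_le_of_ne hτ.1 ?_, lt_of_le_of_ne hτ.2 ?_⟩, heq, fun s hs => ?_⟩
  · rintro rfl; exact h0.ne' heq
  · rintro rfl; exact h1.ne heq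
  · by_contra! hlt
    exact absurd (hmax ⟨⟨hτ.1.trans hs.1.le, hs.2⟩, hlt.le⟩) (not_le.2 hs.1)

variable {E : Type*} [Fintype E] [Nonempty E] {P : Matrix E E ℝ}
  {p : EuclideanSpace ℝ (Fin d) → E → Fin d × ℤˣ → ℝ}

namespace IsJumpModel

variable (M : IsJumpModel P p)
include M

lemma quasiPotentialZero_add_smul_le {x v w N : EuclideanSpace ℝ (Fin d)} {t c B : ℝ}
    (ht : 0 ≤ t) (hc : 0 ≤ c) (hB0 : 0 ≤ B) (hvw : v = w + c • N)
    (hcube : ∀ s ∈ Icc 0 t, x + s • w ∈ cube d)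
    (hN : 0 < c → ∀ s ∈ Icc 0 t, N ∈ outwardNormals (x + s • w))
    (hB : ∀ s ∈ Icc 0 t, lagrangian P p (x + s • w) v ≤ B) :
    quasiPotentialZero P p (x + t • w) ≤ quasiPotentialZero P p x + B * t := by
  have h := M.quasiPotential_add_smul_le (x₀ := 0) ht hc hvw hcube hN hB
  have hx : x ∈ cube d := by simpa using hcube 0 ⟨le_rfl, ht⟩
  have hfin := M.quasiPotential_ne_top hx
  have h2 := ENNReal.toReal_mono (ENNReal.add_ne_top.2 ⟨hfin, ENNReal.ofReal_ne_top⟩) h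
  rwa [ENNReal.toReal_add hfin ENNReal.ofReal_ne_top,
    ENNReal.toReal_ofReal (mul_nonneg hB0 ht)] at h2

/-- If `0 < a < H(x, α)`, duality supplies `v` with `L(x, v) ≤ ⟨α, v⟩ - a`, which contradicts the
hypothesis. The restriction `0 ≤ B` is harmless, as `β = 0` shows. -/
lemma hamiltonian_nonpos_of_forall {x α : EuclideanSpace ℝ (Fin d)}
    (h : ∀ (v : EuclideanSpace ℝ (Fin d)) (B : ℝ), 0 ≤ B →
      (∀ β, inner ℝ β v - hamiltonian P p x β ≤ B) → inner ℝ α v ≤ B) :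
    hamiltonian P p x α ≤ 0 := by
  by_contra! hpos
  obtain ⟨a, ha0, ha⟩ := exists_between hpos
  obtain ⟨v, hv⟩ := M.exists_velocity ha
  have h0 := hv 0
  rw [inner_zero_left, M.hamiltonian_zero, sub_zero] at h0
  linarith [h v _ h0 hv]

/-- Subsolution property at a local maximum. -/
lemma hamiltonian_nonpos_of_localMax {x α : EuclideanSpace ℝ (Fin d)}
    {θ : EuclideanSpace ℝ (Fin d) → ℝ} (hx : x ∈ openCube d)
    (hθ : HasGradientWithinAt θ α (cube d) x)
    (hmax : ∀ᶠ y in 𝓝[cube d] x,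
      quasiPotentialZero P p y - θ y ≤ quasiPotentialZero P p x - θ x) :
    hamiltonian P p x α ≤ 0 := by
  obtain ⟨C, hC0, hC⟩ := M.exists_hamiltonian_lipschitz
  refine M.hamiltonian_nonpos_of_forall fun v B hB0 hB => ?_
  have hxc := openCube_subset_cube hx
  have hmem : ∀ᶠ t : ℝ in 𝓝[>] 0, x + t • (-v) ∈ cube d := by
    have h1 : Tendsto (fun t : ℝ => x + t • (-v)) (𝓝 0) (𝓝 (x + (0 : ℝ) • (-v))) :=
      Continuous.tendsto (by fun_prop) 0
    rw [zero_smul, add_zero] at h1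
    filter_upwards [(h1.eventually (isOpen_openCube.mem_nhds hx)).filter_mono
      nhdsWithin_le_nhds] with t ht using openCube_subset_cube ht
  have hlim := hθ.tendsto_slope hmem
  have hlim2 : Tendsto (fun t : ℝ => -(B + C * (t * ‖v‖))) (𝓝[>] 0) (𝓝 (-B)) := by
    have : Tendsto (fun t : ℝ => -(B + C * (t * ‖v‖))) (𝓝 0) (𝓝 (-(B + C * (0 * ‖v‖)))) :=
      Continuous.tendsto (by fun_prop) 0
    rw [zero_mul, mul_zero, add_zero] at this
    exact this.mono_left nhdsWithin_le_nhds
  have hle := le_of_tendsto_of_tendsto hlim2 hlim ?_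
  · rw [inner_neg_right] at hle
    linarith
  filter_upwards [hmem, (tendsto_add_smul_nhdsWithin hmem).eventually hmax,
    self_mem_nhdsWithin] with t htc htm ht
  have ht : 0 < t := ht
  -- The segment arrives at `x` from `y = x - t v`, which lies in the cube because `x` is interior.
  -- Maximality gives `θ(x) - θ(y) ≤ V(x) - V(y)`.
  set y := x + t • (-v)
  have hyx : y + t • v = x := by simp [y]
  have hcube : ∀ s ∈ Icc 0 t, y + s • v ∈ cube d := fun s hs =>
    add_smul_mem_cube ht htc (hyx ▸ hxc) hs
  have hV := M.quasiPotentialZero_add_smul_le (x := y) (v := v) (w := v) (N := 0) (c := 0)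
    (B := B + C * (t * ‖v‖)) ht.le le_rfl (by positivity) (by simp) hcube (by simp) fun s hs =>
    lagrangian_le fun β => by
      have h1 := hC x hxc _ (hcube s hs) β
      have h2 : ‖x - (y + s • v)‖ ≤ t * ‖v‖ := by
        have e : x - (y + s • v) = (t - s) • v := by simp only [y]; module
        rw [e, norm_smul, Real.norm_of_nonneg (sub_nonneg.2 hs.2)]
        exact mul_le_mul_of_nonneg_right (by linarith [hs.1]) (norm_nonneg _)
      have h3 := mul_le_mul_of_nonneg_left h2 hC0
      linarith [hB β]
  rw [hyx] at hV
  rw [inv_mul_eq_div, le_div_iff₀ ht]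
  linarith

/-- The inequality `H ≤ 0` at a local minimum, at interior points and, under the Neumann
condition, at boundary points. -/
lemma hamiltonian_nonpos_of_localMin {x α : EuclideanSpace ℝ (Fin d)}
    {θ : EuclideanSpace ℝ (Fin d) → ℝ} (hx : x ∈ cube d)
    (hθ : HasGradientWithinAt θ α (cube d) x)
    (hmin : ∀ᶠ y in 𝓝[cube d] x,
      quasiPotentialZero P p x - θ x ≤ quasiPotentialZero P p y - θ y)
    (hα : ∀ n ∈ outwardNormals x, inner ℝ α n ≤ 0) :
    hamiltonian P p x α ≤ 0 := by
  obtain ⟨C, hC0, hC⟩ := M.exists_hamiltonian_lipschitz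
  refine M.hamiltonian_nonpos_of_forall fun v B hB0 hB => ?_
  obtain ⟨c, N, hc, hvw, hN⟩ := exists_outwardNormal_reflectedVelocity (x := x) v
  have hmem := eventually_add_smul_reflectedVelocity_mem hx v
  set w := reflectedVelocity x v
  -- Reflection removes a nonnegative multiple of an outward normal, on which `α` is nonpositive.
  have hvα : inner ℝ α v ≤ inner ℝ α w := by
    rw [hvw, inner_add_right, inner_smul_right]
    rcases hc.eq_or_lt with rfl | hc'
    · simp
    · have := hα N (by simpa using hN hc' 0)
      nlinarith
  refine hvα.trans ?_
  have hlim := hθ.tendsto_slope hmem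
  have hlim2 : Tendsto (fun t : ℝ => B + C * (t * ‖w‖)) (𝓝[>] 0) (𝓝 B) := by
    have : Tendsto (fun t : ℝ => B + C * (t * ‖w‖)) (𝓝 0) (𝓝 (B + C * (0 * ‖w‖))) :=
      Continuous.tendsto (by fun_prop) 0
    rw [zero_mul, mul_zero, add_zero] at this
    exact this.mono_left nhdsWithin_le_nhds
  refine le_of_tendsto_of_tendsto hlim hlim2 ?_
  filter_upwards [hmem, (tendsto_add_smul_nhdsWithin hmem).eventually hmin,
    self_mem_nhdsWithin] with t htc htm ht
  have ht : 0 < t := ht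
  have hcube : ∀ s ∈ Icc 0 t, x + s • w ∈ cube d := fun s hs => add_smul_mem_cube ht hx htc hs
  have hV := M.quasiPotentialZero_add_smul_le (B := B + C * (t * ‖w‖)) ht.le hc (by positivity)
    hvw hcube (fun hc' s _ => hN hc' s) fun s hs => lagrangian_le fun β => by
      have h1 := hC x hx _ (hcube s hs) β
      have h2 : ‖x - (x + s • w)‖ ≤ t * ‖w‖ := by
        rw [sub_add_cancel_left, norm_neg, norm_smul, Real.norm_of_nonneg hs.1]
        exact mul_le_mul_of_nonneg_right hs.2 (norm_nonneg _)
      have h3 := mul_le_mul_of_nonneg_left h2 hC0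
      linarith [hB β]
  rw [inv_mul_eq_div, div_le_iff₀ ht]
  linarith

/-- The last piece of an almost optimal path ending at `x`. -/
lemma exists_quasiPotentialZero_le {x α : EuclideanSpace ℝ (Fin d)} (hx : x ∈ cube d)
    {r ε h : ℝ} (hr : 0 < r) (hrx : r < ‖x‖) (hε : 0 < ε)
    (hα : ∀ y ∈ cube d, ‖y - x‖ ≤ r → ∀ n ∈ outwardNormals y, 0 ≤ inner ℝ α n)
    (hh : ∀ y ∈ cube d, ‖y - x‖ ≤ r → hamiltonian P p y α ≤ -h) (hh0 : 0 ≤ h) :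
    ∃ y ∈ cube d, ‖y - x‖ = r ∧ quasiPotentialZero P p y + inner ℝ α (x - y) + h * (r / √d) ≤
      quasiPotentialZero P p x + ε := by
  have hVx := M.quasiPotential_ne_top hx
  obtain ⟨T, hT, ψ, φ, hψ, hS, h0, h1, hJ⟩ := exists_path_of_quasiPotential_lt
    (ENNReal.lt_add_right hVx (ENNReal.ofReal_pos.2 hε).ne')
  have hlip : ∀ a b, 0 ≤ a → a ≤ b → b ≤ T → ‖ψ b - ψ a‖ ≤ b - a := fun a b ha hab hb =>
    norm_sub_le_of_lintegral_lagrangian_ne_top M hψ (hJ.trans_le le_top).ne ha hab hb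
  -- The path starts at `0`, outside the ball of radius `r < ‖x‖` about `x`; after `τ` it stays in
  -- the closed ball.
  obtain ⟨τ, hτ, hτr, hτle⟩ := exists_last_exit (g := fun s => ‖φ s - x‖) (r := r) hT.le
    ((hS.2.1.sub continuousOn_const).norm) (by simpa [h0] using hrx) (by simpa [h1] using hr)
  have hmaps := hS.2.2.1
  have hτI : τ ∈ Icc 0 T := Ioo_subset_Icc_self hτ
  have hsI : ∀ s ∈ Ioc τ T, s ∈ Icc 0 T := fun s hs => ⟨hτ.1.le.trans hs.1.le, hs.2⟩
  refine ⟨φ τ, hmaps hτI, hτr, ?_⟩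
  have hB := hS.inner_sub_le hτ.1.le hτ.2.le le_rfl (β := α) fun s hs =>
    hα _ (hmaps (hsI s hs)) (hτle s hs)
  have hA := ofReal_le_lintegral_lagrangian (P := P) (p := p) (φ := φ) (β := α) (c := -h) hψ
    hτ.1.le hτ.2.le le_rfl fun s hs => hh _ (hmaps (hsI s hs)) (hτle s hs)
  have hV := quasiPotential_le (P := P) (p := p) hτ.1
    (hψ.mono (by rw [uIcc_of_le hτ.1.le, uIcc_of_le hT.le]; exact Icc_subset_Icc_right hτ.2.le))
    (hS.mono hτ.2.le) h0 rfl
  have hsplit : ∫⁻ s in Icc 0 T, (lagrangian P p (φ s) (deriv ψ s)).toENNReal =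
      (∫⁻ s in Icc 0 τ, (lagrangian P p (φ s) (deriv ψ s)).toENNReal) +
        ∫⁻ s in Ioc τ T, (lagrangian P p (φ s) (deriv ψ s)).toENNReal := by
    rw [← Icc_union_Ioc_eq_Icc hτ.1.le hτ.2.le]
    exact lintegral_union measurableSet_Ioc
      (Set.disjoint_left.2 fun s h1 h2 => not_lt.2 h1.2 h2.1)
  have htot : quasiPotential P p 0 (φ τ) +
      ENNReal.ofReal (inner ℝ α (ψ T - ψ τ) - -h * (T - τ)) ≤
      quasiPotential P p 0 x + ENNReal.ofReal ε :=
    (add_le_add hV hA).trans (hsplit ▸ hJ.le)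
  have hreal := ENNReal.toReal_mono (ENNReal.add_ne_top.2 ⟨hVx, ENNReal.ofReal_ne_top⟩) htot
  rw [ENNReal.toReal_add hVx ENNReal.ofReal_ne_top, ENNReal.toReal_ofReal hε.le,
    ENNReal.toReal_add (M.quasiPotential_ne_top (hmaps hτI)) ENNReal.ofReal_ne_top] at hreal
  -- Truncating the lower bound at zero only increases it, so no sign needs to be known.
  have hmax := (le_max_left (inner ℝ α (ψ T - ψ τ) - -h * (T - τ)) 0).trans_eq
    ENNReal.toReal_ofReal'.symm
  -- The path covers distance `r` at speed at most `√d`.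
  have htime : r / √d ≤ T - τ := by
    have h2 := hS.norm_sub_le hlip hτ.1.le hτ.2.le le_rfl
    rw [h1, norm_sub_rev, hτr] at h2
    exact div_le_of_le_mul₀ (Real.sqrt_nonneg _) (sub_nonneg.2 hτ.2.le) (by rwa [mul_comm])
  have h3 := mul_le_mul_of_nonneg_left htime hh0
  rw [h1] at hB
  change _ ≤ quasiPotentialZero P p x + ε at hreal
  change quasiPotentialZero P p (φ τ) + _ ≤ _ at hreal
  linarith

/-- The inequality `0 ≤ H` at a local minimum different from the origin, at interior points and,
under the Neumann condition, at boundary points. -/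
lemma hamiltonian_nonneg_of_localMin {x α : EuclideanSpace ℝ (Fin d)}
    {θ : EuclideanSpace ℝ (Fin d) → ℝ} (hx : x ∈ cube d) (hx0 : x ≠ 0)
    (hθ : HasGradientWithinAt θ α (cube d) x)
    (hmin : ∀ᶠ y in 𝓝[cube d] x,
      quasiPotentialZero P p x - θ x ≤ quasiPotentialZero P p y - θ y)
    (hα : ∀ n ∈ outwardNormals x, 0 ≤ inner ℝ α n) :
    0 ≤ hamiltonian P p x α := by
  by_contra! hneg
  obtain ⟨C, hC0, hC⟩ := M.exists_hamiltonian_lipschitz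
  obtain ⟨l₀, -⟩ := M.nonempty_index
  have hD : 0 < √(d : ℝ) := Real.sqrt_pos.2 (Nat.cast_pos.2 (Fin.pos l₀))
  set η := -hamiltonian P p x α with hη
  have hη0 : 0 < η := by linarith
  have hκ : 0 < η / (4 * √d) := by positivity
  -- With the unit `η r / (8 √d)`, the Taylor error on the sphere of radius `r` is 2 and the slack
  -- `ε` below is 1, whereas the gain `(η / 2)(r / √d)` is 4.
  have hlo := (hasFDerivWithinAt_iff_isLittleO.1 hθ.hasFDerivWithinAt).def hκ
  obtain ⟨R, hR, hball⟩ := Metric.mem_nhdsWithin_iff.1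
    ((hlo.and hmin).and (eventually_outwardNormals_subset x))
  have hnx : 0 < ‖x‖ := norm_pos_iff.2 hx0
  obtain ⟨r, hr, hrlt⟩ := exists_between (lt_min (lt_min hR hnx)
    (show 0 < η / (2 * (C + 1)) by positivity))
  obtain ⟨⟨hrR, hrx⟩, hrC⟩ := by simpa only [lt_min_iff] using hrlt
  have hin : ∀ y ∈ cube d, ‖y - x‖ ≤ r → y ∈ Metric.ball x R ∩ cube d := fun y hy hyr =>
    ⟨by rw [mem_ball_iff_norm]; exact hyr.trans_lt hrR, hy⟩
  -- This radius keeps `H(·, α) ≤ -η / 2` on the part of the ball inside the cube.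
  have hCr : C * r ≤ η / 2 := by
    rw [lt_div_iff₀ (by positivity)] at hrC
    nlinarith
  obtain ⟨y, hy, hyr, hle⟩ := M.exists_quasiPotentialZero_le (α := α) (h := η / 2)
    (ε := η / (8 * √d) * r) hx hr hrx (by positivity)
    (fun y hy hyr n hn => hα n ((hball (hin y hy hyr)).2 hn))
    (fun y hy hyr => by
      have h1 := hC y hy x hx α
      have h2 := mul_le_mul_of_nonneg_left hyr hC0
      linarith) (by positivity)
  obtain ⟨⟨h1, h2⟩, -⟩ := hball (hin y hy hyr.le)
  simp only [InnerProductSpace.toDual_apply_apply, Real.norm_eq_abs] at h1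
  rw [hyr] at h1
  have h3 := (abs_le.1 h1).1
  have e : inner ℝ α (x - y) = -inner ℝ α (y - x) := by rw [← inner_neg_right, neg_sub]
  have e1 : η / (4 * √d) * r = 2 * (η / (8 * √d) * r) := by field_simp; norm_num
  have e2 : η / 2 * (r / √d) = 4 * (η / (8 * √d) * r) := by field_simp; norm_num
  have hpos : 0 < η / (8 * √d) * r := by positivity
  rw [e, e2] at hle
  rw [e1] at h3
  linarith

end IsJumpModel

end Viscosity

/-! ### Assembly of the interior and boundary statements. -/

lemma outwardNormals_eq_empty {d : ℕ} {x : EuclideanSpace ℝ (Fin d)} (hx : x ∈ openCube d) :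
    outwardNormals x = ∅ := by
  refine eq_empty_of_forall_notMem fun n hn => ?_
  have : n = 0 := by
    ext l
    exact (hn.2 l).1 (hx l)
  simpa [this] using hn.1

theorem mainTheorem7 {d : ℕ} {E : Type*} [Fintype E] [Nonempty E]
    (P : Matrix E E ℝ)
    (hP_sum : ∀ i, ∑ j, P i j = 1)
    (p : EuclideanSpace ℝ (Fin d) → E → Fin d × ℤˣ → ℝ)
    (hp_sum : ∀ x i, ∑ v, p x i v = 1)
    (hA1 : ∃ K : ℝ, ∀ x y i v, |p x i v - p y i v| ≤ K * ‖x - y‖)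
    (hA2 : ∀ x i v, 0 < p x i v)
    (hA3 : P.IsIrreducible) :
    -- the limit defining `H` exists and does not depend on the starting state
    (∀ (x α : EuclideanSpace ℝ (Fin d)) (i : E),
      Tendsto (fun n : ℕ => (1 / (n : ℝ)) * Real.log (expMoment P p i n x α)) atTop
        (𝓝 (hamiltonian P p x α))) ∧
    -- the quasi-potential is finite
    (∀ x ∈ cube d, quasiPotential P p 0 x ≠ ⊤) ∧
    -- viscosity subsolution and bilateral supersolution in the open cube
    (∀ x ∈ openCube d, ∀ U : Set (EuclideanSpace ℝ (Fin d)), IsOpen U → x ∈ U → U ⊆ openCube d →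
      ∀ θ : EuclideanSpace ℝ (Fin d) → ℝ, ContDiffOn ℝ 1 θ U →
        (IsLocalMax (fun y => quasiPotentialZero P p y - θ y) x →
          hamiltonian P p x (gradient θ x) ≤ 0) ∧
        (IsLocalMin (fun y => quasiPotentialZero P p y - θ y) x →
          hamiltonian P p x (gradient θ x) = 0)) ∧
    -- boundary conditions
    (∀ x ∈ frontier (cube d), ∀ U : Set (EuclideanSpace ℝ (Fin d)), IsOpen U → x ∈ U →
      ∀ θ : EuclideanSpace ℝ (Fin d) → ℝ, ContDiffOn ℝ 1 θ (U ∩ cube d) →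
        IsLocalMinOn (fun y => quasiPotentialZero P p y - θ y) (U ∩ cube d) x →
        (x ≠ 0 →
          (∀ n ∈ outwardNormals x, 0 ≤ inner ℝ (gradientWithin θ (U ∩ cube d) x) n) →
          0 ≤ hamiltonian P p x (gradientWithin θ (U ∩ cube d) x)) ∧
        ((∀ n ∈ outwardNormals x, inner ℝ (gradientWithin θ (U ∩ cube d) x) n ≤ 0) →
          hamiltonian P p x (gradientWithin θ (U ∩ cube d) x) ≤ 0)) := by
  have M : IsJumpModel P p := ⟨hP_sum, hA3, hp_sum, hA2, hA1⟩
  refine ⟨fun x α i => ?_, fun x hx => M.quasiPotential_ne_top hx, ?_, ?_⟩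
  · simp only [expMoment_eq_pathMoment]
    exact M.tendsto_hamiltonian x α i
  · intro x hx U hU hxU _ θ hθ
    have hxc := openCube_subset_cube hx
    have hgrad : HasGradientWithinAt θ (gradient θ x) (cube d) x :=
      HasFDerivAt.hasFDerivWithinAt ((hθ.contDiffAt
        (hU.mem_nhds hxU)).differentiableAt one_ne_zero).hasGradientAt.hasFDerivAt
    -- In the interior both Neumann conditions hold vacuously, so the boundary lemmas also cover
    -- local minima there.
    have hempty := outwardNormals_eq_empty hx
    refine ⟨fun hmax => M.hamiltonian_nonpos_of_localMax hx hgrad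
      (hmax.filter_mono nhdsWithin_le_nhds), fun hmin => ?_⟩
    have hmin' := hmin.filter_mono (nhdsWithin_le_nhds (s := cube d))
    refine le_antisymm (M.hamiltonian_nonpos_of_localMin hxc hgrad hmin' (by simp [hempty]))
      (M.hamiltonian_nonneg_of_localMin hxc ?_ hgrad hmin' (by simp [hempty]))
    rintro rfl
    obtain ⟨l, -⟩ := M.nonempty_index
    simpa using (hx l).1
  · intro x hx U hU hxU θ hθ hmin
    have hxc : x ∈ cube d := isClosed_cube.frontier_subset hx
    -- Intersecting with the neighbourhood `U` of `x` changes neither local minimality nor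
    -- differentiability relative to the cube.
    have hnhds : 𝓝[U ∩ cube d] x = 𝓝[cube d] x := by
      rw [inter_comm]
      exact nhdsWithin_inter_of_mem' (mem_nhdsWithin_of_mem_nhds (hU.mem_nhds hxU))
    have hgrad : HasGradientWithinAt θ (gradientWithin θ (U ∩ cube d) x) (cube d) x := by
      have h := ((hθ x ⟨hxU, hxc⟩).differentiableWithinAt one_ne_zero).hasGradientWithinAt
      rw [hasGradientWithinAt_iff_hasFDerivWithinAt] at h ⊢
      rwa [inter_comm, hasFDerivWithinAt_inter (hU.mem_nhds hxU), inter_comm] at h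
    have hmin' : ∀ᶠ y in 𝓝[cube d] x,
        quasiPotentialZero P p x - θ x ≤ quasiPotentialZero P p y - θ y := hnhds ▸ hmin
    exact ⟨fun hx0 hα => M.hamiltonian_nonneg_of_localMin hxc hx0 hgrad hmin' hα,
      fun hα => M.hamiltonian_nonpos_of_localMin hxc hgrad hmin' hα⟩
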